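/- Let ${\sf G}=({\sf V},{\sf E})$ be a countable, connected, locally finite (undirected, simple) graph with path distance $\rho$; write $x\sim y$ if $x$ and $y$ are adjacent, and let $n(x)$ be the degree of $x$. Fix a vertex $o\in{\sf V}$ and $\alpha,\theta>0$, put $w_\alpha(x)=\exp[-\alpha\rho(o,x)]$, and assume $$\Theta(\alpha,\theta)=\sum_{x\in{\sf V}}w_\alpha(x)\sum_{y\sim x}[n(x)n(y)]^\theta<\infty .$$ Let $W:\mathbb R\times\mathbb R\to\mathbb R$ be continuous and symmetric with $|W(u,v)|\le [I_W+J_W(u^2+v^2)]/2$ for all $u,v\in\mathbb R$ and some $I_W,J_W>0$, and let $V:\mathbb R\to\mathbb R$ be continuous with $V(u)\ge a_V|u|^q-c_V$ for all $u\in\mathbb R$ and some $a_V,c_V>0$ and $q>2+2/\theta$. Let $\Omega=\mathbb R^{\sf V}$ carry the product topology and its Borel $\sigma$-field $\mathcal B(\Omega)$. For a finite non-empty $\Lambda\subset{\sf V}$ and $\xi\in\Omega$, let $$H_\Lambda(\omega_\Lambda|\xi)=\sum_{\langle x,y\rangle\in{\sf E}:\,x,y\in\Lambda}W(\omega(x),\omega(y))+\sum_{\langle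 x,y\rangle\in{\sf E}:\,x\in\Lambda,\,y\in\Lambda^c}W(\omega(x),\xi(y))+\sum_{x\in\Lambda}V(\omega(x)),$$ $$\pi_\Lambda(A|\xi)=\frac1{Z_\Lambda(\xi)}\int_{\mathbb R^{\Lambda}}\mathbb I_A(\omega_\Lambda\times\xi_{\Lambda^c})\exp[-H_\Lambda(\omega_\Lambda|\xi)]\,{\rm d}\omega_\Lambda,\qquad A\in\mathcal B(\Omega),$$ where $\omega_\Lambda\times\xi_{\Lambda^c}$ is the configuration equal to $\omega_\Lambda$ on $\Lambda$ and to $\xi$ on $\Lambda^c={\sf V}\setminus\Lambda$, ${\rm d}\omega_\Lambda$ is Lebesgue measure, and $Z_\Lambda(\xi)$ is the normalizing factor. A probability measure $\mu$ on $\Omega$ is a Gibbs measure if $\mu(A)=\int_\Omega\pi_\Lambda(A|\omega)\,\mu({\rm d}\omega)$ for all $A\in\mathcal B(\Omega)$ and all finite non-empty $\Lambda\subset{\sf V}$. Take $p=2+2/\theta$, put $$\|\omega\|_{p,\alpha}=\Big[\sum_{x\in{\sf V}}|\omega(x)|^pw_\alpha(x)\Big]^{1/p}\in[0,\infty],\qquad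 L^p({\sf V},w_\alpha)=\{\omega\in\Omega:\|\omega\|_{p,\alpha}<\infty\},$$ and let $\mathcal G^{\rm t}$ be the set of all tempered Gibbs measures, i.e. of all Gibbs measures $\mu$ with $\mu(L^p({\sf V},w_\alpha))=1$. Then $\mathcal G^{\rm t}$ is non-empty and compact in the weak topology (determined by the bounded continuous functions on $\Omega$). For every $\lambda>0$ and $x\in{\sf V}$ there is a constant $C(\lambda,x)>0$ such that, for all $\mu\in\mathcal G^{\rm t}$, $$\int_\Omega\exp(\lambda|\omega(x)|^p)\,\mu({\rm d}\omega)\le C(\lambda,x).$$ Furthermore, for every $\lambda>0$ there is a constant $C(\lambda)>0$ such that, for all $\mu\in\mathcal G^{\rm t}$, $$\int_\Omega\exp(\lambda\|\omega\|_{p,\alpha}^p)\,\mu({\rm d}\omega)\le C(\lambda).$$ -/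

import Mathlib

open MeasureTheory
open scoped ENNReal

namespace GibbsField

noncomputable section

/-- The weight `w_α(x) = exp(-α ρ(o,x))`, where `ρ` is the path distance of the graph
and `o` is the root. -/
def weight {X : Type*} (G : SimpleGraph X) (o : X) (α : ℝ) (x : X) : ℝ :=
  Real.exp (-(α * (G.dist o x : ℝ)))

/-- `m_θ(x) = ∑_{y ∼ x} [n(x) n(y)]^θ`, where `n(x)` is the degree of `x`. -/
def vertexIndex {X : Type*} (G : SimpleGraph X) [G.LocallyFinite] (θ : ℝ) (x : X) : ℝ :=
  ∑ y ∈ G.neighborFinset x, ((G.degree x : ℝ) * (G.degree y : ℝ)) ^ θ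

/-- `Θ(α, θ) = ∑_x m_θ(x) w_α(x)`, a sum of nonnegative terms with value in `[0, ∞]`. -/
def graphSum {X : Type*} (G : SimpleGraph X) [G.LocallyFinite] (o : X) (α θ : ℝ) : ℝ≥0∞ :=
  ∑' x, ENNReal.ofReal (vertexIndex G θ x * weight G o α x)

open Classical in
/-- The configuration `η × ξ_{Λᶜ}`: equal to `η` on `Λ` and to `ξ` off `Λ`. -/
def glue {X : Type*} (Λ : Finset X) (η : Λ → ℝ) (ξ : X → ℝ) : X → ℝ :=
  fun x => if h : x ∈ Λ then η ⟨x, h⟩ else ξ x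

open Classical in
/-- The relative local Hamiltonian `H_Λ(ω_Λ | ξ)`; it depends on `ω` only through the values
of `ω` on `Λ`. The first sum runs over the undirected edges inside `Λ`: each of them occurs
twice in the double sum over ordered pairs, whence the factor `1/2` (`W` is symmetric).
The second sum runs over the edges that join `Λ` to its complement. -/
def hamiltonian {X : Type*} (G : SimpleGraph X) [G.LocallyFinite]
    (W : ℝ → ℝ → ℝ) (V : ℝ → ℝ) (Λ : Finset X) (ω ξ : X → ℝ) : ℝ :=
  (1 / 2 : ℝ) * (∑ x ∈ Λ, ∑ y ∈ Λ with G.Adj x y, W (ω x) (ω y))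
    + (∑ x ∈ Λ, ∑ y ∈ G.neighborFinset x with y ∉ Λ, W (ω x) (ξ y))
    + ∑ x ∈ Λ, V (ω x)

/-- The measure `exp(-H_Λ(ω_Λ | ξ)) dω_Λ` on `ℝ^Λ`, where `dω_Λ` is Lebesgue measure. -/
def boltzmannMeasure {X : Type*} (G : SimpleGraph X) [G.LocallyFinite]
    (W : ℝ → ℝ → ℝ) (V : ℝ → ℝ) (Λ : Finset X) (ξ : X → ℝ) : Measure (Λ → ℝ) :=
  (volume : Measure (Λ → ℝ)).withDensity
    (fun η => ENNReal.ofReal (Real.exp (-hamiltonian G W V Λ (glue Λ η ξ) ξ)))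

/-- The normalizing factor `Z_Λ(ξ) = ∫ exp(-H_Λ(ω_Λ | ξ)) dω_Λ`. -/
def partitionFunction {X : Type*} (G : SimpleGraph X) [G.LocallyFinite]
    (W : ℝ → ℝ → ℝ) (V : ℝ → ℝ) (Λ : Finset X) (ξ : X → ℝ) : ℝ≥0∞ :=
  ∫⁻ η : Λ → ℝ, ENNReal.ofReal (Real.exp (-hamiltonian G W V Λ (glue Λ η ξ) ξ))

/-- The local Gibbs specification
`π_Λ(A | ξ) = Z_Λ(ξ)⁻¹ ∫ 1_A(ω_Λ × ξ_{Λᶜ}) exp(-H_Λ(ω_Λ | ξ)) dω_Λ`. -/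
def localGibbs {X : Type*} (G : SimpleGraph X) [G.LocallyFinite]
    (W : ℝ → ℝ → ℝ) (V : ℝ → ℝ) (Λ : Finset X) (ξ : X → ℝ) : Measure (X → ℝ) :=
  (partitionFunction G W V Λ ξ)⁻¹ •
    (boltzmannMeasure G W V Λ ξ).map (fun η => glue Λ η ξ)

/-- The set of Gibbs random fields: the probability measures on `ℝ^X` that solve the DLR
equation `μ(A) = ∫ π_Λ(A | ω) μ(dω)` for all Borel `A` and all finite nonempty `Λ`. -/
def gibbsMeasures {X : Type*} (G : SimpleGraph X) [G.LocallyFinite]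
    (W : ℝ → ℝ → ℝ) (V : ℝ → ℝ) : Set (ProbabilityMeasure (X → ℝ)) :=
  {μ | ∀ Λ : Finset X, Λ.Nonempty → ∀ A : Set (X → ℝ), MeasurableSet A →
    (μ : Measure (X → ℝ)) A = ∫⁻ ω, localGibbs G W V Λ ω A ∂(μ : Measure (X → ℝ))}

/-- The weighted norm `‖ω‖_{p,α} = [∑_x |ω(x)|^p w_α(x)]^{1/p}`, with value in `[0, ∞]`. -/
def wnorm {X : Type*} (G : SimpleGraph X) (o : X) (p α : ℝ) (ω : X → ℝ) : ℝ≥0∞ :=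
  (∑' x, ENNReal.ofReal (|ω x| ^ p * weight G o α x)) ^ (1 / p)

/-- The set `L^p(X, w_α)` of configurations of finite weighted norm. -/
def weightedLp {X : Type*} (G : SimpleGraph X) (o : X) (p α : ℝ) : Set (X → ℝ) :=
  {ω | wnorm G o p α ω < ⊤}

/-- The set of tempered Gibbs random fields: those with `μ(L^p(X, w_α)) = 1`. -/
def temperedGibbs {X : Type*} (G : SimpleGraph X) [G.LocallyFinite]
    (W : ℝ → ℝ → ℝ) (V : ℝ → ℝ) (o : X) (p α : ℝ) : Set (ProbabilityMeasure (X → ℝ)) :=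
  {μ | μ ∈ gibbsMeasures G W V ∧ (μ : Measure (X → ℝ)) (weightedLp G o p α) = 1}

end

end GibbsField

open GibbsField

namespace GibbsField

open Function Filter Topology

noncomputable section

/-! ### The local Hamiltonian -/

section Hamiltonian

open scoped Classical

variable {X : Type*} {G : SimpleGraph X} [G.LocallyFinite] {W : ℝ → ℝ → ℝ} {V : ℝ → ℝ}
  {Λ Δ K : Finset X}

/-! The proof rests on one a priori bound, uniform over tempered Gibbs measures. Young's inequality
at `p = 2 + 2/θ` (`mul_sq_le_rpow_div_add`) trades the quadratic interaction along an edge `xy` for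
`κ|ω|^p / (n(x)n(y))` plus a multiple of `[n(x)n(y)]^θ`. Since `V` dominates every multiple of
`|u|^p`, the exponential moment of one spin given its neighbours is at most `exp(C(1 + m_θ(x)) + κ ∑
|ξ(y)|^p/(n(x)n(y)))`, with `κ` as small as desired.

In a finite volume, consistency of the specification and Hölder's inequality turn this into a linear
recursion for the logarithmic moments of the spins. Summed against `w_α`, its neighbour term costs a
factor `e^α`, because weights of adjacent vertices are comparable and the kernel `1/(n(x)n(y))` has
row and column sums at most 1. For small `κ` it is absorbed on the left, and `Θ < ∞` controls the
rest. A second use of Hölder bounds the exponential moment of the weighted sum over `Λ` by `exp(C +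
lT)`, where `T` is the weighted `p`-mass of the boundary condition.

For a tempered Gibbs measure the mass outside `Λ` tends to 0 almost surely, so the DLR equation
yields the bound `e^C` (`exists_expMoment_le`). Conversely, a finite exponential moment implies
temperedness. Hence the tempered Gibbs measures are the Gibbs measures in a fixed moment ball: a
closed set by the Feller property, inside a compact one by tightness. Existence follows from limit
points of the local Gibbs measures with zero boundary condition. -/

theorem glue_eq_updateFinset (Λ : Finset X) (η : Λ → ℝ) (ξ : X → ℝ) :
    glue Λ η ξ = updateFinset ξ Λ η := by
  funext x
  simp [glue, updateFinset]

theorem glue_of_notMem {x : X} (hx : x ∉ Λ) (η : Λ → ℝ) (ξ : X → ℝ) : glue Λ η ξ x = ξ x := by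
  simp [glue, hx]

theorem glue_of_mem {x : X} (hx : x ∈ Λ) (η : Λ → ℝ) (ξ : X → ℝ) :
    glue Λ η ξ x = η ⟨x, hx⟩ := by
  simp [glue, hx]

theorem continuous_glue (Λ : Finset X) :
    Continuous fun z : (Λ → ℝ) × (X → ℝ) => glue Λ z.1 z.2 := by
  refine continuous_pi fun x => ?_
  by_cases hx : x ∈ Λ
  · simp only [glue_of_mem hx]; fun_prop
  · simp only [glue_of_notMem hx]; fun_prop

/-- The boundary spins are read only off `Λ`, where gluing changes nothing. The energy thus becomes
a function of a single configuration. -/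
theorem hamiltonian_glue (Λ : Finset X) (η : Λ → ℝ) (ξ : X → ℝ) :
    hamiltonian G W V Λ (glue Λ η ξ) ξ =
      hamiltonian G W V Λ (glue Λ η ξ) (glue Λ η ξ) := by
  unfold hamiltonian
  congr 2
  refine Finset.sum_congr rfl fun x _ => Finset.sum_congr rfl fun y hy => ?_
  rw [glue_of_notMem (Finset.mem_filter.1 hy).2]

theorem continuous_hamiltonian (hW : Continuous fun z : ℝ × ℝ => W z.1 z.2) (hV : Continuous V)
    (Λ : Finset X) : Continuous fun ω : X → ℝ => hamiltonian G W V Λ ω ω := by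
  have hW' : ∀ x y : X, Continuous fun ω : X → ℝ => W (ω x) (ω y) := fun x y =>
    hW.comp (g := fun z : ℝ × ℝ => W z.1 z.2) (f := fun ω : X → ℝ => (ω x, ω y)) (by fun_prop)
  unfold hamiltonian
  refine Continuous.add (Continuous.add (continuous_const.mul ?_) ?_) ?_
  · exact continuous_finsetSum _ fun x _ => continuous_finsetSum _ fun y _ => hW' x y
  · exact continuous_finsetSum _ fun x _ => continuous_finsetSum _ fun y _ => hW' x y
  · exact continuous_finsetSum _ fun x _ => hV.comp (continuous_apply x)

/-- The finite set of the vertices of `Λ` and their neighbours. -/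
def ball (G : SimpleGraph X) [G.LocallyFinite] (Λ : Finset X) : Finset X :=
  Λ ∪ Λ.biUnion fun x => G.neighborFinset x

theorem subset_ball : Λ ⊆ ball G Λ := Finset.subset_union_left

theorem neighborFinset_subset_ball {x : X} (hx : x ∈ Λ) : G.neighborFinset x ⊆ ball G Λ :=
  fun _ hy => Finset.mem_union_right _ (Finset.mem_biUnion.2 ⟨x, hx, hy⟩)

/-- A boundary edge occurs once in the energy but as two ordered pairs, so the symmetry of `W`
brings everything under a common factor 1/2. The index set `K` may exceed what `Λ` needs, which lets
energies of nested volumes be subtracted term by term. -/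
theorem hamiltonian_eq_half_sum (hsymm : ∀ u v, W u v = W v u) (hK : Λ ⊆ K)
    (hN : ∀ x ∈ Λ, G.neighborFinset x ⊆ K) (ω : X → ℝ) :
    hamiltonian G W V Λ ω ω =
      (1 / 2 : ℝ) * (∑ x ∈ K, ∑ y ∈ K,
        if G.Adj x y ∧ (x ∈ Λ ∨ y ∈ Λ) then W (ω x) (ω y) else 0) + ∑ x ∈ Λ, V (ω x) := by
  set f : X → X → ℝ := fun x y => if G.Adj x y then W (ω x) (ω y) else 0 with hf
  have hfs : ∀ x y, f x y = f y x := fun x y => by simp only [hf, G.adj_comm x y, hsymm (ω x)]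
  have h1 : (∑ x ∈ Λ, ∑ y ∈ Λ with G.Adj x y, W (ω x) (ω y)) =
      ∑ x ∈ K, ∑ y ∈ K, if x ∈ Λ ∧ y ∈ Λ then f x y else 0 := by
    rw [← Finset.sum_subset hK (fun x _ hx => by simp [hx])]
    refine Finset.sum_congr rfl fun x hx => ?_
    rw [← Finset.sum_subset hK (fun y _ hy => by simp [hy]), Finset.sum_filter]
    exact Finset.sum_congr rfl fun y hy => by simp [hx, hy, hf]
  have h2 : (∑ x ∈ Λ, ∑ y ∈ G.neighborFinset x with y ∉ Λ, W (ω x) (ω y)) =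
      ∑ x ∈ K, ∑ y ∈ K, if x ∈ Λ ∧ y ∉ Λ then f x y else 0 := by
    rw [← Finset.sum_subset hK (fun x _ hx => by simp [hx])]
    refine Finset.sum_congr rfl fun x hx => ?_
    rw [Finset.sum_filter, ← Finset.sum_subset (hN x hx) (fun y _ hy => by
      have : ¬ G.Adj x y := by simpa using hy
      simp [hf, this])]
    refine Finset.sum_congr rfl fun y hy => ?_
    have : G.Adj x y := by simpa using hy
    simp [hx, hf, this]
  have h3 : (∑ x ∈ K, ∑ y ∈ K, if x ∈ Λ ∧ y ∉ Λ then f x y else 0) =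
      ∑ x ∈ K, ∑ y ∈ K, if x ∉ Λ ∧ y ∈ Λ then f x y else 0 := by
    rw [Finset.sum_comm]
    refine Finset.sum_congr rfl fun x _ => Finset.sum_congr rfl fun y _ => ?_
    rw [hfs y x]
    simp only [and_comm]
  have h4 : (∑ x ∈ K, ∑ y ∈ K,
        if G.Adj x y ∧ (x ∈ Λ ∨ y ∈ Λ) then W (ω x) (ω y) else 0) =
      (∑ x ∈ K, ∑ y ∈ K, if x ∈ Λ ∧ y ∈ Λ then f x y else 0) +
      (∑ x ∈ K, ∑ y ∈ K, if x ∈ Λ ∧ y ∉ Λ then f x y else 0) +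
      ∑ x ∈ K, ∑ y ∈ K, if x ∉ Λ ∧ y ∈ Λ then f x y else 0 := by
    simp only [← Finset.sum_add_distrib]
    refine Finset.sum_congr rfl fun x _ => Finset.sum_congr rfl fun y _ => ?_
    by_cases hx : x ∈ Λ <;> by_cases hy : y ∈ Λ <;> simp [hx, hy, hf]
  rw [hamiltonian, h4, ← h3, h1, h2]
  ring

/-- The part of the energy in `Λ` that is not in the energy in `Δ ⊆ Λ` does not depend on
the spins in `Δ`. -/
theorem hamiltonian_sub_congr (hsymm : ∀ u v, W u v = W v u) (hΔ : Δ ⊆ Λ) {ω ω' : X → ℝ}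
    (h : ∀ x ∉ Δ, ω x = ω' x) :
    hamiltonian G W V Λ ω ω - hamiltonian G W V Δ ω ω =
      hamiltonian G W V Λ ω' ω' - hamiltonian G W V Δ ω' ω' := by
  have key : ∀ σ : X → ℝ, hamiltonian G W V Λ σ σ - hamiltonian G W V Δ σ σ =
      (1 / 2 : ℝ) * (∑ x ∈ ball G Λ, ∑ y ∈ ball G Λ,
        if G.Adj x y ∧ (x ∈ Λ ∨ y ∈ Λ) ∧ x ∉ Δ ∧ y ∉ Δ then W (σ x) (σ y) else 0)
        + ∑ x ∈ Λ \ Δ, V (σ x) := fun σ => by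
    rw [hamiltonian_eq_half_sum hsymm subset_ball
        (fun x hx => neighborFinset_subset_ball (Λ := Λ) hx),
      hamiltonian_eq_half_sum hsymm (hΔ.trans subset_ball)
        (fun x hx => neighborFinset_subset_ball (hΔ hx)), ← Finset.sum_sdiff hΔ]
    have : ∀ a b c d e : ℝ, a = d + b → 1 / 2 * a + (e + c) - (1 / 2 * b + c) = 1 / 2 * d + e :=
      fun a b c d e h => by rw [h]; ring
    apply this
    simp only [← Finset.sum_add_distrib]
    refine Finset.sum_congr rfl fun x _ => Finset.sum_congr rfl fun y _ => ?_
    have hx : x ∈ Δ → x ∈ Λ := fun h => hΔ h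
    have hy : y ∈ Δ → y ∈ Λ := fun h => hΔ h
    by_cases h1 : x ∈ Δ <;> by_cases h2 : y ∈ Δ <;> by_cases h3 : G.Adj x y <;>
      simp [h1, h2, h3, hx, hy]
  rw [key, key]
  congr 1
  · congr 1
    refine Finset.sum_congr rfl fun x _ => Finset.sum_congr rfl fun y _ => ?_
    split_ifs with hc
    · rw [h x hc.2.2.1, h y hc.2.2.2]
    · rfl
  · exact Finset.sum_congr rfl fun x hx => by rw [h x (Finset.mem_sdiff.1 hx).2]

theorem hamiltonian_singleton (x : X) (ω : X → ℝ) :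
    hamiltonian G W V {x} ω ω = (∑ y ∈ G.neighborFinset x, W (ω x) (ω y)) + V (ω x) := by
  have h : (G.neighborFinset x).filter (fun y => y ∉ ({x} : Finset X)) = G.neighborFinset x := by
    refine Finset.filter_true_of_mem fun y hy => ?_
    have : G.Adj x y := by simpa using hy
    simpa using this.ne'
  simp only [hamiltonian, Finset.sum_singleton, h]
  rw [Finset.sum_eq_zero fun y hy => ?_]
  · ring
  · obtain ⟨h1, h2⟩ := Finset.mem_filter.1 hy
    rw [Finset.mem_singleton] at h1
    exact absurd h2 (by simp [h1])

theorem exists_neg_hamiltonian_le {I J : ℝ} (hI : 0 < I) (hJ : 0 < J)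
    (hW : ∀ u v : ℝ, |W u v| ≤ (I + J * (u ^ 2 + v ^ 2)) / 2) (Λ : Finset X) :
    ∃ D : ℝ, 0 ≤ D ∧ ∀ ω : X → ℝ, -hamiltonian G W V Λ ω ω ≤
      D + D * (∑ x ∈ ball G Λ, ω x ^ 2) - ∑ x ∈ Λ, V (ω x) := by
  set S : (X → ℝ) → ℝ := fun ω => ∑ x ∈ ball G Λ, ω x ^ 2 with hS
  have hS0 : ∀ ω, 0 ≤ S ω := fun ω => Finset.sum_nonneg fun _ _ => sq_nonneg _
  have hS1 : ∀ ω, ∀ x ∈ ball G Λ, ω x ^ 2 ≤ S ω := fun ω x hx =>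
    Finset.single_le_sum (f := fun x => ω x ^ 2) (fun _ _ => sq_nonneg _) hx
  have hterm : ∀ ω : X → ℝ, ∀ x ∈ ball G Λ, ∀ y ∈ ball G Λ,
      |W (ω x) (ω y)| ≤ (I + J) * (1 + S ω) := fun ω x hx y hy => by
    have h1 := hW (ω x) (ω y)
    have h2 := mul_le_mul_of_nonneg_left (hS1 ω x hx) hJ.le
    have h3 := mul_le_mul_of_nonneg_left (hS1 ω y hy) hJ.le
    have h4 := mul_nonneg hI.le (hS0 ω)
    nlinarith
  obtain ⟨N1, hN1⟩ : ∃ N : ℝ, N = ∑ x ∈ Λ, ∑ y ∈ Λ with G.Adj x y, (1 : ℝ) := ⟨_, rfl⟩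
  obtain ⟨N2, hN2⟩ : ∃ N : ℝ, N = ∑ x ∈ Λ, ∑ y ∈ G.neighborFinset x with y ∉ Λ, (1 : ℝ) :=
    ⟨_, rfl⟩
  have hN1' : 0 ≤ N1 :=
    hN1 ▸ Finset.sum_nonneg fun _ _ => Finset.sum_nonneg fun _ _ => zero_le_one
  have hN2' : 0 ≤ N2 :=
    hN2 ▸ Finset.sum_nonneg fun _ _ => Finset.sum_nonneg fun _ _ => zero_le_one
  -- `N1` and `N2` count the pair terms of the two sums; each term is at most `(I + J)(1 + S ω)`.
  refine ⟨(N1 + N2) * (I + J), by positivity, fun ω => ?_⟩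
  have e1 : -(N1 * ((I + J) * (1 + S ω))) ≤ ∑ x ∈ Λ, ∑ y ∈ Λ with G.Adj x y, W (ω x) (ω y) := by
    rw [hN1, Finset.sum_mul, ← Finset.sum_neg_distrib]
    refine Finset.sum_le_sum fun x hx => ?_
    rw [Finset.sum_mul, ← Finset.sum_neg_distrib]
    refine Finset.sum_le_sum fun y hy => ?_
    rw [one_mul]
    exact (abs_le.1 (hterm ω x (subset_ball hx) y (subset_ball (Finset.mem_filter.1 hy).1))).1
  have e2 : -(N2 * ((I + J) * (1 + S ω))) ≤
      ∑ x ∈ Λ, ∑ y ∈ G.neighborFinset x with y ∉ Λ, W (ω x) (ω y) := by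
    rw [hN2, Finset.sum_mul, ← Finset.sum_neg_distrib]
    refine Finset.sum_le_sum fun x hx => ?_
    rw [Finset.sum_mul, ← Finset.sum_neg_distrib]
    refine Finset.sum_le_sum fun y hy => ?_
    rw [one_mul]
    exact (abs_le.1 (hterm ω x (subset_ball hx) y
      (neighborFinset_subset_ball hx (Finset.mem_filter.1 hy).1))).1
  have e3 : 0 ≤ N1 * ((I + J) * (1 + S ω)) :=
    mul_nonneg hN1' (mul_nonneg (by linarith) (by linarith [hS0 ω]))
  unfold hamiltonian
  change _ ≤ (N1 + N2) * (I + J) + (N1 + N2) * (I + J) * S ω - _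
  linarith [show (N1 + N2) * (I + J) + (N1 + N2) * (I + J) * S ω =
    N1 * ((I + J) * (1 + S ω)) + N2 * ((I + J) * (1 + S ω)) by ring]

end Hamiltonian

/-! ### Stability of the interaction -/

/-- Continuous, symmetric pair interaction of at most quadratic growth, together with a continuous
self-interaction which dominates `|u| ^ p` for some `p > 2`. -/
structure IsStable (W : ℝ → ℝ → ℝ) (V : ℝ → ℝ) (p : ℝ) (I J : ℝ) : Prop where
  continuous_pair : Continuous fun z : ℝ × ℝ => W z.1 z.2
  symm : ∀ u v, W u v = W v u
  pos_const : 0 < I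
  pos_coeff : 0 < J
  abs_pair_le : ∀ u v : ℝ, |W u v| ≤ (I + J * (u ^ 2 + v ^ 2)) / 2
  continuous_self : Continuous V
  two_lt : 2 < p
  dominates : ∀ l : ℝ, ∃ C : ℝ, ∀ u : ℝ, l * |u| ^ p - V u ≤ C

/-- `T` is the crossover point where `|l| T^p = a T^q`: beyond it the higher power wins, below it
`|l| T^p` suffices. -/
theorem exists_mul_rpow_le {p q a : ℝ} (hp : 0 < p) (hpq : p < q) (ha : 0 < a) (l : ℝ) :
    ∃ C : ℝ, ∀ t : ℝ, 0 ≤ t → l * t ^ p ≤ a * t ^ q + C := by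
  set T : ℝ := (|l| / a) ^ (1 / (q - p)) with hT
  have hT0 : 0 ≤ T := by positivity
  refine ⟨|l| * T ^ p, fun t ht => ?_⟩
  have h0 : l * t ^ p ≤ |l| * t ^ p :=
    mul_le_mul_of_nonneg_right (le_abs_self l) (Real.rpow_nonneg ht p)
  refine h0.trans ?_
  rcases le_total t T with h | h
  · have h1 : t ^ p ≤ T ^ p := Real.rpow_le_rpow ht h hp.le
    have h2 : 0 ≤ a * t ^ q := by positivity
    nlinarith [mul_le_mul_of_nonneg_left h1 (abs_nonneg l)]
  · have h1 : |l| / a ≤ t ^ (q - p) := by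
      have := Real.rpow_le_rpow hT0 h (sub_pos.2 hpq).le
      rwa [hT, ← Real.rpow_mul (by positivity), one_div_mul_cancel (sub_pos.2 hpq).ne',
        Real.rpow_one] at this
    have h2 : t ^ q = t ^ (q - p) * t ^ p := by
      rw [← Real.rpow_add_of_nonneg ht (sub_pos.2 hpq).le hp.le, sub_add_cancel]
    have h3 : |l| ≤ a * t ^ (q - p) := by rwa [div_le_iff₀' ha] at h1
    have h4 : 0 ≤ |l| * T ^ p := by positivity
    rw [h2]
    nlinarith [mul_le_mul_of_nonneg_right h3 (Real.rpow_nonneg ht p)]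

theorem sq_le_one_add_rpow {p : ℝ} (hp : 2 ≤ p) (u : ℝ) : u ^ 2 ≤ 1 + |u| ^ p := by
  rcases le_total |u| 1 with h | h
  · have : u ^ 2 ≤ 1 := by rw [← sq_abs]; exact pow_le_one₀ (abs_nonneg u) h
    linarith [Real.rpow_nonneg (abs_nonneg u) p]
  · have : |u| ^ (2 : ℝ) ≤ |u| ^ p := Real.rpow_le_rpow_of_exponent_le h hp
    rw [Real.rpow_two, sq_abs] at this
    linarith

/-! ### The local specification: normalization, consistency, Feller property -/

section LocalMeasure

open scoped Classical

variable {X : Type*} {G : SimpleGraph X} [G.LocallyFinite] {W : ℝ → ℝ → ℝ} {V : ℝ → ℝ}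
  {Λ Δ K : Finset X} {p I J : ℝ}

theorem IsStable.exists_self_le (h : IsStable W V p I J) (l D : ℝ) :
    ∃ C : ℝ, ∀ u : ℝ, l * |u| ^ p + D * u ^ 2 - V u ≤ C - u ^ 2 := by
  obtain ⟨C, hC⟩ := h.dominates (l + (|D| + 1))
  refine ⟨C + (|D| + 1), fun u => ?_⟩
  have h1 := hC u
  have h2 := mul_le_mul_of_nonneg_left (sq_le_one_add_rpow h.two_lt.le u)
    (by positivity : 0 ≤ |D| + 1)
  have h3 := mul_le_mul_of_nonneg_right (le_abs_self D) (sq_nonneg u)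
  nlinarith

/-- The self-interaction in `Λ` absorbs both the quadratic pair energy and `l|ω(x)|^p`, and still
leaves a Gaussian exponent. Only boundary spins keep a positive quadratic term, which is constant
under integration over `Λ`. -/
theorem IsStable.exists_exponent_le (h : IsStable W V p I J) (G : SimpleGraph X)
    [G.LocallyFinite] (Λ : Finset X) (l : ℝ) :
    ∃ A D : ℝ, 0 ≤ D ∧ ∀ ω : X → ℝ,
      l * (∑ x ∈ Λ, |ω x| ^ p) - hamiltonian G W V Λ ω ω ≤
        A + D * (∑ z ∈ ball G Λ \ Λ, ω z ^ 2) - ∑ x ∈ Λ, ω x ^ 2 := by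
  obtain ⟨D, hD0, hD⟩ := exists_neg_hamiltonian_le (G := G) (V := V) h.pos_const h.pos_coeff
    h.abs_pair_le Λ
  obtain ⟨C, hC⟩ := h.exists_self_le l D
  refine ⟨D + ∑ x ∈ Λ, C, D, hD0, fun ω => ?_⟩
  have h1 := hD ω
  have h2 := Finset.sum_le_sum fun x (_ : x ∈ Λ) => hC (ω x)
  rw [← Finset.sum_sdiff (subset_ball (G := G) (Λ := Λ))] at h1
  simp only [Finset.sum_sub_distrib, Finset.sum_add_distrib, ← Finset.mul_sum] at h2
  linarith

/-- The density `exp (-H_Λ)` as a function of the full configuration. -/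
def boltzmannWeight (G : SimpleGraph X) [G.LocallyFinite] (W : ℝ → ℝ → ℝ) (V : ℝ → ℝ)
    (Λ : Finset X) (ω : X → ℝ) : ℝ≥0∞ :=
  ENNReal.ofReal (Real.exp (-hamiltonian G W V Λ ω ω))

theorem boltzmannWeight_ne_zero (ω : X → ℝ) : boltzmannWeight G W V Λ ω ≠ 0 := by
  simp [boltzmannWeight, Real.exp_pos]

theorem IsStable.continuous_boltzmannWeight (h : IsStable W V p I J) (Λ : Finset X) :
    Continuous (boltzmannWeight G W V Λ) :=
  ENNReal.continuous_ofReal.comp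
    (Real.continuous_exp.comp
      (continuous_hamiltonian h.continuous_pair h.continuous_self Λ).neg)

theorem measurable_glue (Λ : Finset X) (ξ : X → ℝ) : Measurable fun η : Λ → ℝ => glue Λ η ξ := by
  simp only [glue_eq_updateFinset]
  exact measurable_updateFinset

theorem partitionFunction_eq_lintegral (ξ : X → ℝ) :
    partitionFunction G W V Λ ξ = ∫⁻ η : Λ → ℝ, boltzmannWeight G W V Λ (glue Λ η ξ) := by
  simp only [partitionFunction, boltzmannWeight, hamiltonian_glue]

theorem partitionFunction_eq (ξ : X → ℝ) :
    partitionFunction G W V Λ ξ = (∫⋯∫⁻_Λ, boltzmannWeight G W V Λ) ξ := by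
  simp only [partitionFunction_eq_lintegral, lmarginal, glue_eq_updateFinset]
  rfl

theorem lintegral_exp_neg_sum_sq_lt_top (ι : Type*) [Fintype ι] :
    ∫⁻ η : ι → ℝ, ENNReal.ofReal (Real.exp (-∑ i, η i ^ 2)) < ⊤ := by
  have h1 : Integrable (fun u : ℝ => Real.exp (-u ^ 2)) := by
    simpa using integrable_exp_neg_mul_sq (b := 1) one_pos
  have h2 : Integrable (fun η : ι → ℝ => Real.exp (-∑ i, η i ^ 2)) := by
    have := Integrable.fintype_prod (ι := ι) (f := fun _ u => Real.exp (-u ^ 2))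
      (μ := fun _ => (volume : Measure ℝ)) fun _ => h1
    simp only [← Real.exp_sum, Finset.sum_neg_distrib] at this
    exact this
  exact h2.lintegral_lt_top

theorem sum_glue_sq (η : Λ → ℝ) (ξ : X → ℝ) : ∑ x ∈ Λ, glue Λ η ξ x ^ 2 = ∑ i, η i ^ 2 := by
  rw [← Finset.sum_coe_sort Λ fun x => glue Λ η ξ x ^ 2]
  exact Fintype.sum_congr _ _ fun i => by rw [glue_of_mem i.2]

theorem sum_sdiff_glue_sq (η : Λ → ℝ) (ξ : X → ℝ) :
    ∑ z ∈ K \ Λ, glue Λ η ξ z ^ 2 = ∑ z ∈ K \ Λ, ξ z ^ 2 :=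
  Finset.sum_congr rfl fun z hz => by rw [glue_of_notMem (Finset.mem_sdiff.1 hz).2]

theorem lmarginal_mul_left {f g : (X → ℝ) → ℝ≥0∞} (hg : ∀ ω, g ω ≠ ⊤)
    (hgΔ : ∀ ω ω' : X → ℝ, (∀ x ∉ Δ, ω x = ω' x) → g ω = g ω') (ξ : X → ℝ) :
    (∫⋯∫⁻_Δ, fun ω => g ω * f ω) ξ = g ξ * (∫⋯∫⁻_Δ, f) ξ := by
  simp only [lmarginal]
  rw [← lintegral_const_mul' _ _ (hg ξ)]
  refine lintegral_congr fun η => ?_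
  rw [hgΔ (updateFinset ξ Δ η) ξ fun x hx => by simp [updateFinset, hx]]

theorem IsStable.lintegral_exp_mul_boltzmannWeight_lt_top (h : IsStable W V p I J) (l : ℝ)
    (ξ : X → ℝ) :
    ∫⁻ η : Λ → ℝ, ENNReal.ofReal (Real.exp (l * ∑ x ∈ Λ, |glue Λ η ξ x| ^ p)) *
      boltzmannWeight G W V Λ (glue Λ η ξ) < ⊤ := by
  obtain ⟨A, D, -, hD⟩ := h.exists_exponent_le G Λ l
  refine lt_of_le_of_lt (lintegral_mono (g := fun η : Λ → ℝ =>
    ENNReal.ofReal (Real.exp (A + D * (∑ z ∈ ball G Λ \ Λ, ξ z ^ 2))) *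
      ENNReal.ofReal (Real.exp (-∑ i, η i ^ 2))) fun η => ?_) ?_
  · dsimp only [boltzmannWeight]
    rw [← ENNReal.ofReal_mul (Real.exp_pos _).le, ← ENNReal.ofReal_mul (Real.exp_pos _).le,
      ← Real.exp_add, ← Real.exp_add]
    refine ENNReal.ofReal_le_ofReal (Real.exp_le_exp.2 ?_)
    have h1 := hD (glue Λ η ξ)
    rw [sum_sdiff_glue_sq, sum_glue_sq] at h1
    linarith
  · rw [lintegral_const_mul' _ _ ENNReal.ofReal_ne_top]
    exact ENNReal.mul_lt_top ENNReal.ofReal_lt_top (lintegral_exp_neg_sum_sq_lt_top Λ)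

theorem IsStable.partitionFunction_ne_top (h : IsStable W V p I J) (Λ : Finset X) (ξ : X → ℝ) :
    partitionFunction G W V Λ ξ ≠ ⊤ := by
  have := h.lintegral_exp_mul_boltzmannWeight_lt_top (G := G) (Λ := Λ) 0 ξ
  rw [partitionFunction_eq_lintegral]
  simpa using this.ne

variable [Countable X]

theorem IsStable.measurable_boltzmannWeight (h : IsStable W V p I J) (Λ : Finset X) :
    Measurable (boltzmannWeight G W V Λ) :=
  (h.continuous_boltzmannWeight Λ).measurable

theorem IsStable.partitionFunction_ne_zero (h : IsStable W V p I J) (Λ : Finset X) (ξ : X → ℝ) :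
    partitionFunction G W V Λ ξ ≠ 0 := by
  rw [partitionFunction_eq_lintegral]
  intro h0
  have hm : Measurable fun η : Λ → ℝ => boltzmannWeight G W V Λ (glue Λ η ξ) :=
    (h.measurable_boltzmannWeight Λ).comp (measurable_glue Λ ξ)
  rw [lintegral_eq_zero_iff hm] at h0
  have : ∀ᵐ η : Λ → ℝ, False := h0.mono fun η hη => boltzmannWeight_ne_zero _ hη
  rw [eventually_false_iff_eq_bot, ae_eq_bot] at this
  exact (NeZero.ne (volume : Measure (Λ → ℝ))) this

theorem IsStable.lintegral_localGibbs (h : IsStable W V p I J) (Λ : Finset X) (ξ : X → ℝ)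
    {f : (X → ℝ) → ℝ≥0∞} (hf : Measurable f) :
    ∫⁻ ω, f ω ∂localGibbs G W V Λ ξ = (partitionFunction G W V Λ ξ)⁻¹ *
      ∫⁻ η : Λ → ℝ, boltzmannWeight G W V Λ (glue Λ η ξ) * f (glue Λ η ξ) := by
  rw [localGibbs, lintegral_smul_measure, lintegral_map hf (measurable_glue Λ ξ),
    boltzmannMeasure]
  simp only [hamiltonian_glue]
  change _ • ∫⁻ η, f (glue Λ η ξ) ∂(volume.withDensity
    fun η : Λ → ℝ => boltzmannWeight G W V Λ (glue Λ η ξ)) = _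
  have hm : Measurable fun η : Λ → ℝ => boltzmannWeight G W V Λ (glue Λ η ξ) :=
    (h.measurable_boltzmannWeight Λ).comp (measurable_glue Λ ξ)
  have hm' : Measurable fun η : Λ → ℝ => f (glue Λ η ξ) := hf.comp (measurable_glue Λ ξ)
  rw [lintegral_withDensity_eq_lintegral_mul _ hm hm']
  rfl

theorem IsStable.lintegral_localGibbs_eq_lmarginal (h : IsStable W V p I J) (Λ : Finset X)
    (ξ : X → ℝ) {f : (X → ℝ) → ℝ≥0∞} (hf : Measurable f) :
    ∫⁻ ω, f ω ∂localGibbs G W V Λ ξ = (partitionFunction G W V Λ ξ)⁻¹ *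
      (∫⋯∫⁻_Λ, fun ω => boltzmannWeight G W V Λ ω * f ω) ξ := by
  rw [h.lintegral_localGibbs Λ ξ hf]
  simp only [lmarginal, glue_eq_updateFinset]
  rfl

theorem IsStable.isProbabilityMeasure_localGibbs (h : IsStable W V p I J) (Λ : Finset X)
    (ξ : X → ℝ) : IsProbabilityMeasure (localGibbs G W V Λ ξ) := by
  constructor
  rw [← lintegral_one, h.lintegral_localGibbs Λ ξ measurable_const]
  simp only [mul_one]
  rw [← partitionFunction_eq_lintegral]
  exact ENNReal.inv_mul_cancel (h.partitionFunction_ne_zero Λ ξ) (h.partitionFunction_ne_top Λ ξ)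

/-- The local Gibbs measure is carried by configurations that agree with `ξ` off `Λ`, so the
integrands need comparing only there. -/
theorem IsStable.lintegral_localGibbs_mono (h : IsStable W V p I J) {ξ : X → ℝ}
    {f g : (X → ℝ) → ℝ≥0∞} (hf : Measurable f) (hg : Measurable g)
    (hfg : ∀ ω : X → ℝ, (∀ x ∉ Λ, ω x = ξ x) → f ω ≤ g ω) :
    ∫⁻ ω, f ω ∂localGibbs G W V Λ ξ ≤ ∫⁻ ω, g ω ∂localGibbs G W V Λ ξ := by
  rw [h.lintegral_localGibbs Λ ξ hf, h.lintegral_localGibbs Λ ξ hg]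
  gcongr with η
  exact hfg _ fun x hx => glue_of_notMem hx η ξ

theorem IsStable.measurable_partitionFunction (h : IsStable W V p I J) (Λ : Finset X) :
    Measurable (partitionFunction G W V Λ) := by
  have : partitionFunction G W V Λ = ∫⋯∫⁻_Λ, boltzmannWeight G W V Λ :=
    funext partitionFunction_eq
  rw [this]
  exact (h.measurable_boltzmannWeight Λ).lmarginal _

theorem IsStable.measurable_lintegral_localGibbs (h : IsStable W V p I J) (Λ : Finset X)
    {f : (X → ℝ) → ℝ≥0∞} (hf : Measurable f) :
    Measurable fun ξ => ∫⁻ ω, f ω ∂localGibbs G W V Λ ξ := by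
  simp only [fun ξ => h.lintegral_localGibbs_eq_lmarginal (G := G) Λ ξ hf]
  exact (h.measurable_partitionFunction Λ).inv.mul
    (((h.measurable_boltzmannWeight Λ).mul hf).lmarginal _)

theorem IsStable.measurable_localGibbs (h : IsStable W V p I J) (Λ : Finset X) :
    Measurable (localGibbs G W V Λ) := by
  refine Measure.measurable_of_measurable_coe _ fun s hs => ?_
  have := h.measurable_lintegral_localGibbs (G := G) Λ
    (f := s.indicator 1) (measurable_one.indicator hs)
  simpa only [lintegral_indicator_one hs] using this

/-- Consistency of the local Gibbs specification. -/
theorem IsStable.lintegral_lintegral_localGibbs (h : IsStable W V p I J) (hΔ : Δ ⊆ Λ)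
    (ξ : X → ℝ) {f : (X → ℝ) → ℝ≥0∞} (hf : Measurable f) :
    ∫⁻ ω, ∫⁻ σ, f σ ∂localGibbs G W V Δ ω ∂localGibbs G W V Λ ξ =
      ∫⁻ ω, f ω ∂localGibbs G W V Λ ξ := by
  have hF := h.measurable_lintegral_localGibbs (G := G) Δ hf
  rw [h.lintegral_localGibbs_eq_lmarginal Λ ξ hf, h.lintegral_localGibbs_eq_lmarginal Λ ξ hF]
  congr 1
  set F : (X → ℝ) → ℝ≥0∞ := fun ω => ∫⁻ σ, f σ ∂localGibbs G W V Δ ω with hFdef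
  -- `g` is the part of the Boltzmann factor of `Λ` that is independent of the spins in `Δ`. Pulling
  -- it out of the `Δ`-integral reduces the claim to the volume `Δ` itself.
  set g : (X → ℝ) → ℝ≥0∞ := fun ω => ENNReal.ofReal
    (Real.exp (-(hamiltonian G W V Λ ω ω - hamiltonian G W V Δ ω ω))) with hg
  have hgt : ∀ ω, g ω ≠ ⊤ := fun ω => ENNReal.ofReal_ne_top
  have hgΔ : ∀ ω ω' : X → ℝ, (∀ x ∉ Δ, ω x = ω' x) → g ω = g ω' := fun ω ω' hω => by
    simp only [hg, hamiltonian_sub_congr h.symm hΔ hω]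
  have hfac : ∀ ω, boltzmannWeight G W V Λ ω = g ω * boltzmannWeight G W V Δ ω := fun ω => by
    simp only [hg, boltzmannWeight]
    rw [← ENNReal.ofReal_mul (Real.exp_pos _).le, ← Real.exp_add]
    congr 2
    ring
  -- `F` does not depend on the spins in `Δ`, so integrating the weight alone produces the partition
  -- function, which cancels the normalization in `F`.
  have hFt : ∀ ω, (∫⋯∫⁻_Δ, fun ω => boltzmannWeight G W V Δ ω * F ω) ω =
      (∫⋯∫⁻_Δ, fun ω => boltzmannWeight G W V Δ ω * f ω) ω := fun ω => by
    have hZ0 := h.partitionFunction_ne_zero (G := G) Δ ω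
    have hZt := h.partitionFunction_ne_top (G := G) Δ ω
    have hFc : ∀ η : Δ → ℝ, F (updateFinset ω Δ η) = F ω := fun η => by
      simp only [hFdef]
      rw [h.lintegral_localGibbs_eq_lmarginal Δ _ hf, h.lintegral_localGibbs_eq_lmarginal Δ _ hf,
        partitionFunction_eq, partitionFunction_eq,
        lmarginal_congr _ (y := ω) _ (fun x hx => by simp [updateFinset, hx]),
        lmarginal_congr _ (y := ω) (fun ω => boltzmannWeight G W V Δ ω * f ω)
          (fun x hx => by simp [updateFinset, hx])]
    have h1 : (∫⋯∫⁻_Δ, fun ω => boltzmannWeight G W V Δ ω * F ω) ω =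
        (∫⋯∫⁻_Δ, boltzmannWeight G W V Δ) ω * F ω := by
      simp only [lmarginal, hFc]
      exact lintegral_mul_const _ ((h.measurable_boltzmannWeight Δ).comp measurable_updateFinset)
    rw [h1, ← partitionFunction_eq]
    simp only [hFdef]
    rw [h.lintegral_localGibbs_eq_lmarginal Δ _ hf, ← mul_assoc, ENNReal.mul_inv_cancel hZ0 hZt,
      one_mul]
  refine congrFun (lmarginal_eq_of_subset hΔ ((h.measurable_boltzmannWeight Λ).mul hF)
    ((h.measurable_boltzmannWeight Λ).mul hf) ?_) ξ
  funext ω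
  have hF' : (∫⋯∫⁻_Δ, fun ω => boltzmannWeight G W V Λ ω * F ω) =
      ∫⋯∫⁻_Δ, fun ω => g ω * (boltzmannWeight G W V Δ ω * F ω) := by
    simp only [hfac, mul_assoc]
  have hf' : (∫⋯∫⁻_Δ, fun ω => boltzmannWeight G W V Λ ω * f ω) =
      ∫⋯∫⁻_Δ, fun ω => g ω * (boltzmannWeight G W V Δ ω * f ω) := by
    simp only [hfac, mul_assoc]
  change (∫⋯∫⁻_Δ, fun ω => boltzmannWeight G W V Λ ω * F ω) ω =
    (∫⋯∫⁻_Δ, fun ω => boltzmannWeight G W V Λ ω * f ω) ω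
  rw [hF', hf']
  rw [lmarginal_mul_left hgt hgΔ, lmarginal_mul_left hgt hgΔ, hFt]

/-- The Feller property of the local Gibbs specification, for unnormalized integrals. -/
theorem IsStable.continuous_lintegral_boltzmannWeight (h : IsStable W V p I J) (Λ : Finset X)
    {f : (X → ℝ) → ℝ≥0∞} (hf : Continuous f) {M : ℝ≥0∞} (hM : M ≠ ⊤) (hfM : ∀ ω, f ω ≤ M) :
    Continuous fun ξ => ∫⁻ η : Λ → ℝ, boltzmannWeight G W V Λ (glue Λ η ξ) * f (glue Λ η ξ) := by
  have hbt : ∀ ω, boltzmannWeight G W V Λ ω ≠ ⊤ := fun ω => ENNReal.ofReal_ne_top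
  have hft : ∀ ω, f ω ≠ ⊤ := fun ω => ne_top_of_le_ne_top hM (hfM ω)
  have hprod : Continuous fun ω => boltzmannWeight G W V Λ ω * f ω :=
    continuous_iff_continuousAt.2 fun ω => ENNReal.Tendsto.mul
      (h.continuous_boltzmannWeight Λ).continuousAt (Or.inr (hft ω))
      hf.continuousAt (Or.inr (hbt ω))
  refine continuous_iff_continuousAt.2 fun ξ₀ => ?_
  obtain ⟨A, D, hD0, hD⟩ := h.exists_exponent_le G Λ 0
  set T : (X → ℝ) → ℝ := fun ξ => ∑ z ∈ ball G Λ \ Λ, ξ z ^ 2 with hT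
  have hTc : Continuous T := by fun_prop
  -- Near `ξ₀` the boundary term is below `T ξ₀ + 1`, which gives one Gaussian majorant for the
  -- whole neighbourhood.
  refine tendsto_lintegral_filter_of_dominated_convergence (fun η : Λ → ℝ =>
    ENNReal.ofReal (Real.exp (A + D * (T ξ₀ + 1))) *
      ENNReal.ofReal (Real.exp (-∑ i, η i ^ 2)) * M) ?_ ?_ ?_ ?_
  · exact Eventually.of_forall fun ξ => hprod.measurable.comp (measurable_glue Λ ξ)
  · have : ∀ᶠ ξ in 𝓝 ξ₀, T ξ < T ξ₀ + 1 := hTc.continuousAt.eventually_lt_const (by linarith)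
    filter_upwards [this] with ξ hξ
    refine Eventually.of_forall fun η => mul_le_mul' ?_ (hfM _)
    rw [← ENNReal.ofReal_mul (Real.exp_pos _).le, ← Real.exp_add, boltzmannWeight]
    refine ENNReal.ofReal_le_ofReal (Real.exp_le_exp.2 ?_)
    have h1 := hD (glue Λ η ξ)
    rw [sum_sdiff_glue_sq, sum_glue_sq] at h1
    change _ ≤ A + D * T ξ - _ at h1
    have := mul_le_mul_of_nonneg_left hξ.le hD0
    linarith
  · rw [lintegral_mul_const' _ _ hM, lintegral_const_mul' _ _ ENNReal.ofReal_ne_top]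
    exact ENNReal.mul_ne_top (ENNReal.mul_ne_top ENNReal.ofReal_ne_top
      (lintegral_exp_neg_sum_sq_lt_top Λ).ne) hM
  · refine Eventually.of_forall fun η => ?_
    exact (hprod.comp ((continuous_glue Λ).comp (Continuous.prodMk_right η))).continuousAt

theorem IsStable.continuous_lintegral_localGibbs (h : IsStable W V p I J) (Λ : Finset X)
    {f : (X → ℝ) → ℝ≥0∞} (hf : Continuous f) {M : ℝ≥0∞} (hM : M ≠ ⊤) (hfM : ∀ ω, f ω ≤ M) :
    Continuous fun ξ => ∫⁻ ω, f ω ∂localGibbs G W V Λ ξ := by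
  simp only [fun ξ => h.lintegral_localGibbs (G := G) Λ ξ hf.measurable]
  have h1 := h.continuous_lintegral_boltzmannWeight (G := G) Λ hf hM hfM
  have h2 := h.continuous_lintegral_boltzmannWeight (G := G) Λ (f := fun _ => 1)
    continuous_const ENNReal.one_ne_top fun _ => le_rfl
  simp only [mul_one, ← partitionFunction_eq_lintegral] at h2
  refine continuous_iff_continuousAt.2 fun ξ => ENNReal.Tendsto.mul
    ((continuous_inv.comp h2).tendsto ξ) (Or.inr ?_) (h1.tendsto ξ) (Or.inr ?_)
  · have h3 : ∫⁻ η : Λ → ℝ, boltzmannWeight G W V Λ (glue Λ η ξ) * f (glue Λ η ξ) ≤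
        partitionFunction G W V Λ ξ * M := by
      rw [partitionFunction_eq_lintegral, ← lintegral_mul_const' _ _ hM]
      exact lintegral_mono fun η => mul_le_mul' le_rfl (hfM _)
    exact ne_top_of_le_ne_top (ENNReal.mul_ne_top (h.partitionFunction_ne_top Λ ξ) hM) h3
  · exact ENNReal.inv_ne_top.2 (h.partitionFunction_ne_zero Λ ξ)

end LocalMeasure

/-! ### Exponential moments of a single spin -/

/-- This is Young's inequality with conjugate exponents `1 + 1/θ` and `1 + θ`, obtained by comparing
`t^(1/θ)` with `JN/κ`. It dictates the relation between `p` and `θ`. -/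
theorem mul_sq_le_rpow_div_add {θ J κ N : ℝ} (hθ : 0 < θ) (hJ : 0 < J) (hκ : 0 < κ) (hN : 1 ≤ N)
    (u : ℝ) : J * u ^ 2 ≤ κ * (|u| ^ (2 + 2 / θ) / N) + J * (J / κ) ^ θ * N ^ θ := by
  have hN0 : 0 < N := by linarith
  obtain ⟨t, ht⟩ : ∃ t, t = u ^ 2 := ⟨_, rfl⟩
  have ht0 : 0 ≤ t := ht ▸ sq_nonneg u
  have hpow : |u| ^ (2 + 2 / θ) = t * t ^ (1 / θ) := by
    rw [Real.rpow_add_of_nonneg (abs_nonneg u) (by norm_num) (by positivity), Real.rpow_two,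
      sq_abs, ht, ← sq_abs u, ← Real.rpow_two, ← Real.rpow_mul (abs_nonneg u), mul_one_div]
  have hA : 0 ≤ J * (J / κ) ^ θ * N ^ θ := by positivity
  rw [hpow, ← ht]
  rcases le_total (J * N / κ) (t ^ (1 / θ)) with h | h
  · have h1 : J ≤ κ * (t ^ (1 / θ) / N) := by
      rw [div_le_iff₀ hκ] at h
      rw [← mul_div_assoc, le_div_iff₀ hN0]
      linarith
    have h2 := mul_le_mul_of_nonneg_right h1 ht0
    calc J * t ≤ κ * (t ^ (1 / θ) / N) * t := h2
      _ = κ * (t * t ^ (1 / θ) / N) := by ring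
      _ ≤ _ := by linarith
  · have h1 := Real.rpow_le_rpow (Real.rpow_nonneg ht0 _) h hθ.le
    rw [← Real.rpow_mul ht0, one_div_mul_cancel hθ.ne', Real.rpow_one,
      mul_div_right_comm, Real.mul_rpow (by positivity) hN0.le] at h1
    have h2 := mul_le_mul_of_nonneg_left h1 hJ.le
    have h3 : 0 ≤ κ * (t * t ^ (1 / θ) / N) := by positivity
    linarith

/-! ### Weights and degree sums on the graph -/

section Graph

open scoped Classical

variable {X : Type*} {G : SimpleGraph X} {o : X} {α θ : ℝ}

theorem weight_pos (x : X) : 0 < weight G o α x := Real.exp_pos _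

theorem weight_le_of_adj (hG : G.Connected) (hα : 0 < α) {x y : X} (h : G.Adj x y) :
    weight G o α x ≤ Real.exp α * weight G o α y := by
  have h1 := hG.dist_triangle (u := o) (v := x) (w := y)
  rw [SimpleGraph.dist_eq_one_iff_adj.2 h] at h1
  have h2 : (G.dist o y : ℝ) ≤ G.dist o x + 1 := by exact_mod_cast h1
  rw [weight, weight, ← Real.exp_add]
  refine Real.exp_le_exp.2 ?_
  nlinarith

variable [G.LocallyFinite]

theorem one_le_degree_of_adj {x y : X} (h : G.Adj x y) : (1 : ℝ) ≤ G.degree x := by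
  have : 0 < G.degree x := (G.degree_pos_iff_exists_adj x).2 ⟨y, h⟩
  exact_mod_cast this

theorem sum_neighborFinset_inv_le_one (x : X) :
    ∑ y ∈ G.neighborFinset x, ((G.degree x : ℝ) * G.degree y)⁻¹ ≤ 1 := by
  calc ∑ y ∈ G.neighborFinset x, ((G.degree x : ℝ) * G.degree y)⁻¹
      ≤ ∑ y ∈ G.neighborFinset x, (G.degree x : ℝ)⁻¹ := by
        refine Finset.sum_le_sum fun y hy => ?_
        have hxy : G.Adj x y := by simpa using hy
        have h1 := one_le_degree_of_adj hxy
        have h2 := one_le_degree_of_adj hxy.symm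
        rw [mul_inv]
        exact mul_le_of_le_one_right (by positivity) (inv_le_one_of_one_le₀ h2)
    _ ≤ 1 := by
        rw [Finset.sum_const, G.card_neighborFinset_eq_degree, nsmul_eq_mul]
        exact mul_inv_le_one

/-- After exchanging the sums, the symmetry of the kernel makes each column sum a row sum at `y`,
hence at most 1. -/
theorem sum_sum_neighborFinset_le {φ : X → ℝ} (hφ : ∀ x, 0 ≤ φ x) (A B : Finset X) :
    ∑ x ∈ A, ∑ y ∈ G.neighborFinset x with y ∈ B, φ y / ((G.degree x : ℝ) * G.degree y) ≤
      ∑ y ∈ B, φ y := by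
  have h1 : ∀ x, ∑ y ∈ G.neighborFinset x with y ∈ B, φ y / ((G.degree x : ℝ) * G.degree y) =
      ∑ y ∈ B, if G.Adj x y then φ y / ((G.degree x : ℝ) * G.degree y) else 0 := fun x => by
    rw [← Finset.sum_filter]
    refine Finset.sum_congr ?_ fun _ _ => rfl
    ext y
    simp [and_comm]
  simp only [h1]
  rw [Finset.sum_comm]
  refine Finset.sum_le_sum fun y _ => ?_
  have h2 : (∑ x ∈ A, if G.Adj x y then φ y / ((G.degree x : ℝ) * G.degree y) else 0) ≤
      ∑ x ∈ G.neighborFinset y, φ y * ((G.degree y : ℝ) * G.degree x)⁻¹ := by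
    rw [← Finset.sum_filter]
    refine (Finset.sum_le_sum_of_subset_of_nonneg (t := G.neighborFinset y) ?_ ?_).trans
      (le_of_eq ?_)
    · intro x hx
      simpa [G.adj_comm] using (Finset.mem_filter.1 hx).2
    · intro x _ _
      exact div_nonneg (hφ y) (by positivity)
    · exact Finset.sum_congr rfl fun x _ => by rw [div_eq_mul_inv, mul_comm (G.degree x : ℝ)]
  rw [← Finset.mul_sum] at h2
  exact h2.trans (mul_le_of_le_one_right (hφ y) (sum_neighborFinset_inv_le_one y))

theorem vertexIndex_nonneg (x : X) : 0 ≤ vertexIndex G θ x :=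
  Finset.sum_nonneg fun _ _ => by positivity

theorem one_le_vertexIndex (hθ : 0 < θ) {x y : X} (h : G.Adj x y) : 1 ≤ vertexIndex G θ x := by
  have h1 : (1 : ℝ) ≤ ((G.degree x : ℝ) * G.degree y) ^ θ :=
    Real.one_le_rpow (one_le_mul_of_one_le_of_one_le (one_le_degree_of_adj h)
      (one_le_degree_of_adj h.symm)) hθ.le
  exact h1.trans (Finset.single_le_sum (f := fun y => ((G.degree x : ℝ) * G.degree y) ^ θ)
    (fun _ _ => by positivity) (by simpa using h))

/-- Away from isolated vertices `m_θ ≥ 1`, so the finiteness of `Θ` also controls the total weight.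
A connected graph with an isolated vertex has only that vertex; there `m_θ` vanishes and the single
weight is added by hand. -/
theorem exists_sum_weight_le (hG : G.Connected) (hθ : 0 < θ) (hsum : graphSum G o α θ < ⊤) :
    ∃ M : ℝ, 0 < M ∧ ∀ F : Finset X, ∑ x ∈ F, weight G o α x ≤ M ∧
      ∑ x ∈ F, vertexIndex G θ x * weight G o α x ≤ M := by
  have hm : ∀ F : Finset X, ∑ x ∈ F, vertexIndex G θ x * weight G o α x ≤
      (graphSum G o α θ).toReal := fun F => by
    rw [← ENNReal.ofReal_le_iff_le_toReal hsum.ne, ENNReal.ofReal_sum_of_nonneg fun x _ =>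
      mul_nonneg (vertexIndex_nonneg x) (weight_pos x).le]
    exact ENNReal.sum_le_tsum F
  by_cases hX : ∀ x : X, ∃ y, G.Adj x y
  · refine ⟨(graphSum G o α θ).toReal + 1, by positivity, fun F => ⟨?_, by linarith [hm F]⟩⟩
    have : ∑ x ∈ F, weight G o α x ≤ ∑ x ∈ F, vertexIndex G θ x * weight G o α x := by
      refine Finset.sum_le_sum fun x _ => ?_
      obtain ⟨y, hy⟩ := hX x
      exact le_mul_of_one_le_left (weight_pos x).le (one_le_vertexIndex hθ hy)
    linarith [hm F]
  · have hs : Subsingleton X := by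
      by_contra hn
      rw [not_subsingleton_iff_nontrivial] at hn
      exact hX fun x => hG.preconnected.exists_adj_of_nontrivial x
    refine ⟨(graphSum G o α θ).toReal + weight G o α o, by
      have := weight_pos (G := G) (o := o) (α := α) o
      positivity, fun F => ⟨?_, by linarith [hm F, weight_pos (G := G) (o := o) (α := α) o]⟩⟩
    have : ∑ x ∈ F, weight G o α x ≤ ∑ x ∈ {o}, weight G o α x :=
      Finset.sum_le_sum_of_subset_of_nonneg
        (fun x _ => Finset.mem_singleton.2 (Subsingleton.elim x o)) fun x _ _ => (weight_pos x).le
    rw [Finset.sum_singleton] at this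
    linarith [ENNReal.toReal_nonneg (a := graphSum G o α θ)]

end Graph

/-! ### The one-point conditional estimate -/

section SingleSpin

open scoped Classical

variable {X : Type*} {G : SimpleGraph X} [G.LocallyFinite] {W : ℝ → ℝ → ℝ} {V : ℝ → ℝ}
  {p I J θ : ℝ}

/-- The interaction of a vertex with its neighbours is dominated by `p`-th powers of spins, up to
a constant proportional to the vertex index. -/
theorem IsStable.exists_abs_sum_pair_le (h : IsStable W V p I J) (hθ : 0 < θ)
    (hp : p = 2 + 2 / θ) {κ : ℝ} (hκ : 0 < κ) :
    ∃ C : ℝ, 0 ≤ C ∧ ∀ (x : X) (ω : X → ℝ),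
      |∑ y ∈ G.neighborFinset x, W (ω x) (ω y)| ≤ C * vertexIndex G θ x + κ * |ω x| ^ p +
        κ * ∑ y ∈ G.neighborFinset x, |ω y| ^ p / ((G.degree x : ℝ) * G.degree y) := by
  have hI := h.pos_const
  have hJ := h.pos_coeff
  refine ⟨I + J * (J / κ) ^ θ, by positivity, fun x ω => ?_⟩
  have h1 : ∀ y ∈ G.neighborFinset x, |W (ω x) (ω y)| ≤
      (I + J * (J / κ) ^ θ) * ((G.degree x : ℝ) * G.degree y) ^ θ +
      κ * |ω x| ^ p * ((G.degree x : ℝ) * G.degree y)⁻¹ +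
      κ * (|ω y| ^ p / ((G.degree x : ℝ) * G.degree y)) := fun y hy => by
    have hxy : G.Adj x y := by simpa using hy
    have hN : (1 : ℝ) ≤ (G.degree x : ℝ) * G.degree y :=
      one_le_mul_of_one_le_of_one_le (one_le_degree_of_adj hxy) (one_le_degree_of_adj hxy.symm)
    obtain ⟨N, hNe⟩ : ∃ N : ℝ, N = (G.degree x : ℝ) * G.degree y := ⟨_, rfl⟩
    rw [← hNe] at hN ⊢
    have e1 := mul_sq_le_rpow_div_add hθ hJ hκ hN (ω x)
    have e2 := mul_sq_le_rpow_div_add hθ hJ hκ hN (ω y)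
    rw [← hp] at e1 e2
    have e3 : I * 1 ≤ I * N ^ θ := mul_le_mul_of_nonneg_left (Real.one_le_rpow hN hθ.le) hI.le
    have e4 := h.abs_pair_le (ω x) (ω y)
    have e5 : 0 ≤ κ * (|ω x| ^ p / N) := by positivity
    have e6 : 0 ≤ κ * (|ω y| ^ p / N) := by positivity
    have e7 : κ * |ω x| ^ p * N⁻¹ = κ * (|ω x| ^ p / N) := by ring
    rw [e7]
    linarith
  refine (Finset.abs_sum_le_sum_abs _ _).trans ((Finset.sum_le_sum h1).trans ?_)
  rw [Finset.sum_add_distrib, Finset.sum_add_distrib, ← Finset.mul_sum, ← Finset.mul_sum,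
    ← Finset.mul_sum]
  have h2 : κ * |ω x| ^ p * ∑ y ∈ G.neighborFinset x, ((G.degree x : ℝ) * G.degree y)⁻¹ ≤
      κ * |ω x| ^ p :=
    mul_le_of_le_one_right (by positivity) (sum_neighborFinset_inv_le_one x)
  rw [vertexIndex]
  linarith

theorem IsStable.lintegral_exp_self_lt_top (h : IsStable W V p I J) (l : ℝ) :
    ∫⁻ u : ℝ, ENNReal.ofReal (Real.exp (l * |u| ^ p - V u)) < ⊤ := by
  obtain ⟨C, hC⟩ := h.exists_self_le l 0
  have h1 : Integrable (fun u : ℝ => Real.exp (-u ^ 2)) := by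
    simpa using integrable_exp_neg_mul_sq (b := 1) one_pos
  refine lt_of_le_of_lt (lintegral_mono (g := fun u =>
    ENNReal.ofReal (Real.exp C * Real.exp (-u ^ 2))) fun u => ?_)
    (h1.const_mul (Real.exp C)).lintegral_lt_top
  refine ENNReal.ofReal_le_ofReal ?_
  rw [← Real.exp_add]
  exact Real.exp_le_exp.2 (by linarith [hC u])

theorem IsStable.lintegral_exp_self_ne_zero (h : IsStable W V p I J) (l : ℝ) :
    ∫⁻ u : ℝ, ENNReal.ofReal (Real.exp (l * |u| ^ p - V u)) ≠ 0 := by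
  have hV := h.continuous_self.measurable
  intro h0
  rw [lintegral_eq_zero_iff (by fun_prop)] at h0
  have : ∀ᵐ _ : ℝ, False := h0.mono fun u hu => by
    simp [(Real.exp_pos _).not_ge] at hu
  rw [eventually_false_iff_eq_bot, ae_eq_bot] at this
  exact (NeZero.ne (volume : Measure ℝ)) this

/-- The interaction energy of a spin `u` at `x` lies within `±(E + (κ/2)|u|^p)`, with `E`
independent of `u`. The numerator is therefore at most `e^E A` and the partition function at least
`e^(-E) B`, where the one-dimensional integrals `A` and `B` depend on neither `x` nor `ξ`. -/
theorem IsStable.exists_lintegral_localGibbs_singleton_le [Countable X] (h : IsStable W V p I J)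
    (hθ : 0 < θ) (hp : p = 2 + 2 / θ) (l : ℝ) {κ : ℝ} (hκ : 0 < κ) :
    ∃ C : ℝ, 0 ≤ C ∧ ∀ (x : X) (ξ : X → ℝ),
      ∫⁻ ω, ENNReal.ofReal (Real.exp (l * |ω x| ^ p)) ∂localGibbs G W V {x} ξ ≤
        ENNReal.ofReal (Real.exp (C * (1 + vertexIndex G θ x) +
          κ * ∑ y ∈ G.neighborFinset x, |ξ y| ^ p / ((G.degree x : ℝ) * G.degree y))) := by
  -- The ratio contains `e^(2E)`, so half of `κ` is spent on each of numerator and denominator.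
  have hκ2 : 0 < κ / 2 := by linarith
  obtain ⟨C₁, hC₁0, hC₁⟩ := h.exists_abs_sum_pair_le (G := G) hθ hp hκ2
  obtain ⟨A, hA⟩ : ∃ A, A = ∫⁻ u : ℝ, ENNReal.ofReal (Real.exp ((l + κ / 2) * |u| ^ p - V u)) :=
    ⟨_, rfl⟩
  obtain ⟨B, hB⟩ : ∃ B, B = ∫⁻ u : ℝ, ENNReal.ofReal (Real.exp (-(κ / 2) * |u| ^ p - V u)) :=
    ⟨_, rfl⟩
  have hAt : A ≠ ⊤ := hA ▸ (h.lintegral_exp_self_lt_top _).ne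
  have hBt : B ≠ ⊤ := hB ▸ (h.lintegral_exp_self_lt_top _).ne
  have hB0 : B ≠ 0 := hB ▸ h.lintegral_exp_self_ne_zero _
  obtain ⟨C₀, hC₀0, hC₀⟩ : ∃ C₀ : ℝ, 0 ≤ C₀ ∧ B⁻¹ * A ≤ ENNReal.ofReal (Real.exp C₀) := by
    refine ⟨(B⁻¹ * A).toReal, ENNReal.toReal_nonneg, ?_⟩
    have ht : B⁻¹ * A ≠ ⊤ := ENNReal.mul_ne_top (ENNReal.inv_ne_top.2 hB0) hAt
    rw [← ENNReal.ofReal_toReal ht, ENNReal.toReal_ofReal ENNReal.toReal_nonneg]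
    exact ENNReal.ofReal_le_ofReal (by linarith [Real.add_one_le_exp (B⁻¹ * A).toReal])
  refine ⟨C₀ + 2 * C₁, by positivity, fun x ξ => ?_⟩
  obtain ⟨S, hS⟩ : ∃ S : ℝ, S = ∑ y ∈ G.neighborFinset x, |ξ y| ^ p /
    ((G.degree x : ℝ) * G.degree y) := ⟨_, rfl⟩
  obtain ⟨E, hE⟩ : ∃ E : ℝ, E = C₁ * vertexIndex G θ x + κ / 2 * S := ⟨_, rfl⟩
  have hW : ∀ u : ℝ, |∑ y ∈ G.neighborFinset x, W u (ξ y)| ≤ E + κ / 2 * |u| ^ p := fun u => by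
    have h1 := hC₁ x (update ξ x u)
    have h2 : ∀ y ∈ G.neighborFinset x, update ξ x u y = ξ y := fun y hy => by
      have hxy : G.Adj x y := by simpa using hy
      exact update_of_ne hxy.ne' _ _
    have h3 : ∑ y ∈ G.neighborFinset x, W (update ξ x u x) (update ξ x u y) =
        ∑ y ∈ G.neighborFinset x, W u (ξ y) :=
      Finset.sum_congr rfl fun y hy => by rw [h2 y hy, update_self]
    have h4 : ∑ y ∈ G.neighborFinset x, |update ξ x u y| ^ p / ((G.degree x : ℝ) * G.degree y) =
        S := hS ▸ Finset.sum_congr rfl fun y hy => by rw [h2 y hy]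
    rw [h3, h4, update_self] at h1
    linarith
  have hham : ∀ u : ℝ, hamiltonian G W V {x} (update ξ x u) (update ξ x u) =
      (∑ y ∈ G.neighborFinset x, W u (ξ y)) + V u := fun u => by
    rw [hamiltonian_singleton, update_self]
    congr 1
    refine Finset.sum_congr rfl fun y hy => ?_
    have hxy : G.Adj x y := by simpa using hy
    rw [update_of_ne hxy.ne']
  have hmeas : Measurable fun ω : X → ℝ => ENNReal.ofReal (Real.exp (l * |ω x| ^ p)) := by
    fun_prop
  rw [h.lintegral_localGibbs_eq_lmarginal {x} ξ hmeas, partitionFunction_eq, lmarginal_singleton,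
    lmarginal_singleton]
  have hnum : ∫⁻ u : ℝ, boltzmannWeight G W V {x} (update ξ x u) *
      ENNReal.ofReal (Real.exp (l * |update ξ x u x| ^ p)) ≤
      ENNReal.ofReal (Real.exp E) * A := by
    rw [hA, ← lintegral_const_mul' _ _ ENNReal.ofReal_ne_top]
    refine lintegral_mono fun u => ?_
    rw [boltzmannWeight, ← ENNReal.ofReal_mul (Real.exp_pos _).le,
      ← ENNReal.ofReal_mul (Real.exp_pos _).le, ← Real.exp_add, ← Real.exp_add, hham, update_self]
    refine ENNReal.ofReal_le_ofReal (Real.exp_le_exp.2 ?_)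
    linarith [(abs_le.1 (hW u)).1]
  have hden : ENNReal.ofReal (Real.exp (-E)) * B ≤
      ∫⁻ u : ℝ, boltzmannWeight G W V {x} (update ξ x u) := by
    rw [hB, ← lintegral_const_mul' _ _ ENNReal.ofReal_ne_top]
    refine lintegral_mono fun u => ?_
    rw [boltzmannWeight, ← ENNReal.ofReal_mul (Real.exp_pos _).le, ← Real.exp_add, hham]
    refine ENNReal.ofReal_le_ofReal (Real.exp_le_exp.2 ?_)
    linarith [(abs_le.1 (hW u)).2]
  refine (mul_le_mul' (ENNReal.inv_le_inv.2 hden) hnum).trans ?_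
  rw [ENNReal.mul_inv (Or.inr hBt) (Or.inr hB0), ← ENNReal.ofReal_inv_of_pos (Real.exp_pos _),
    ← Real.exp_neg, neg_neg]
  calc ENNReal.ofReal (Real.exp E) * B⁻¹ * (ENNReal.ofReal (Real.exp E) * A)
      = ENNReal.ofReal (Real.exp E) * ENNReal.ofReal (Real.exp E) * (B⁻¹ * A) := by ring
    _ ≤ ENNReal.ofReal (Real.exp E) * ENNReal.ofReal (Real.exp E) *
        ENNReal.ofReal (Real.exp C₀) := by gcongr
    _ = ENNReal.ofReal (Real.exp (E + E + C₀)) := by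
        rw [← ENNReal.ofReal_mul (Real.exp_pos _).le, ← Real.exp_add,
          ← ENNReal.ofReal_mul (Real.exp_pos _).le, ← Real.exp_add]
    _ ≤ _ := by
        rw [← hS]
        refine ENNReal.ofReal_le_ofReal (Real.exp_le_exp.2 ?_)
        have hm := vertexIndex_nonneg (G := G) (θ := θ) x
        rw [hE]
        nlinarith [mul_nonneg hC₀0 hm]

end SingleSpin

/-! ### Logarithmic exponential moments -/

/-- The logarithm of the exponential moment of `g`. -/
def logMoment {Ω : Type*} [MeasurableSpace Ω] (ν : Measure Ω) (g : Ω → ℝ) : ℝ :=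
  Real.log (∫⁻ ω, ENNReal.ofReal (Real.exp (g ω)) ∂ν).toReal

section LogMoment

variable {Ω ι : Type*} [MeasurableSpace Ω] {ν : Measure Ω} [IsProbabilityMeasure ν]

theorem one_le_lintegral_exp {g : Ω → ℝ} (hg : ∀ ω, 0 ≤ g ω) :
    1 ≤ ∫⁻ ω, ENNReal.ofReal (Real.exp (g ω)) ∂ν := by
  calc (1 : ℝ≥0∞) = ∫⁻ _, 1 ∂ν := by simp
    _ ≤ _ := lintegral_mono fun ω => by
      rw [← ENNReal.ofReal_one]
      exact ENNReal.ofReal_le_ofReal (Real.one_le_exp (hg ω))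

theorem ofReal_exp_logMoment {g : Ω → ℝ} (hg : ∀ ω, 0 ≤ g ω)
    (ht : ∫⁻ ω, ENNReal.ofReal (Real.exp (g ω)) ∂ν ≠ ⊤) :
    ENNReal.ofReal (Real.exp (logMoment ν g)) = ∫⁻ ω, ENNReal.ofReal (Real.exp (g ω)) ∂ν := by
  have h0 := zero_lt_one.trans_le (one_le_lintegral_exp (ν := ν) hg)
  rw [logMoment, Real.exp_log (ENNReal.toReal_pos h0.ne' ht), ENNReal.ofReal_toReal ht]

/-- No finiteness is needed: an infinite moment has `toReal` equal to 0, and `Real.log 0 = 0`. -/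
theorem logMoment_nonneg {g : Ω → ℝ} (hg : ∀ ω, 0 ≤ g ω) : 0 ≤ logMoment ν g := by
  by_cases ht : ∫⁻ ω, ENNReal.ofReal (Real.exp (g ω)) ∂ν = ⊤
  · simp [logMoment, ht]
  · have := one_le_lintegral_exp (ν := ν) hg
    rw [← ofReal_exp_logMoment hg ht, ENNReal.one_le_ofReal] at this
    exact Real.one_le_exp_iff.1 this

/-- Hölder's inequality for exponentials. -/
theorem lintegral_exp_sum_le {s : Finset ι} {g : ι → Ω → ℝ} {c : ι → ℝ}
    (hg : ∀ i ∈ s, ∀ ω, 0 ≤ g i ω) (hm : ∀ i ∈ s, Measurable (g i))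
    (ht : ∀ i ∈ s, ∫⁻ ω, ENNReal.ofReal (Real.exp (g i ω)) ∂ν ≠ ⊤)
    (hc : ∀ i ∈ s, 0 ≤ c i) (hc1 : ∑ i ∈ s, c i ≤ 1) :
    ∫⁻ ω, ENNReal.ofReal (Real.exp (∑ i ∈ s, c i * g i ω)) ∂ν ≤
      ENNReal.ofReal (Real.exp (∑ i ∈ s, c i * logMoment ν (g i))) := by
  have hexp : ∀ a : ι → ℝ, ENNReal.ofReal (Real.exp (∑ i ∈ s, c i * a i)) =
      ∏ i ∈ s, ENNReal.ofReal (Real.exp (a i)) ^ c i := fun a => by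
    rw [Real.exp_sum, ENNReal.ofReal_prod_of_nonneg fun _ _ => (Real.exp_pos _).le]
    refine Finset.prod_congr rfl fun i _ => ?_
    rw [ENNReal.ofReal_rpow_of_pos (Real.exp_pos _), ← Real.exp_mul, mul_comm]
  -- The missing exponent `1 - ∑ c i` is given to the constant function 1, so coefficients of sum at
  -- most 1 suffice on a probability space.
  have h := ENNReal.lintegral_mul_prod_norm_pow_le (μ := ν) s (g := fun _ => 1)
    (f := fun i ω => ENNReal.ofReal (Real.exp (g i ω))) aemeasurable_const
    (fun i hi => by have := hm i hi; fun_prop) (1 - ∑ i ∈ s, c i) (p := c) (by ring)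
    (by linarith) hc
  simp only [ENNReal.one_rpow, one_mul, lintegral_one, measure_univ] at h
  simp only [hexp]
  refine h.trans (le_of_eq (Finset.prod_congr rfl fun i hi => ?_))
  rw [ofReal_exp_logMoment (hg i hi) (ht i hi)]

end LogMoment

/-! ### Moment bounds uniform in the finite volume -/

section VolumeEstimate

open scoped Classical

variable {X : Type*} [Countable X] {G : SimpleGraph X} [G.LocallyFinite] {W : ℝ → ℝ → ℝ}
  {V : ℝ → ℝ} {Λ : Finset X} {o : X} {p I J θ α : ℝ}

/-- Only finiteness is claimed, with no uniformity in `Λ` or `ξ`. It makes the logarithmic moments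
genuine, so that the recursion can later be solved by absorption. -/
theorem IsStable.lintegral_exp_rpow_ne_top (h : IsStable W V p I J) {l : ℝ} (hl : 0 ≤ l)
    {x : X} (hx : x ∈ Λ) (ξ : X → ℝ) :
    ∫⁻ ω, ENNReal.ofReal (Real.exp (l * |ω x| ^ p)) ∂localGibbs G W V Λ ξ ≠ ⊤ := by
  rw [h.lintegral_localGibbs Λ ξ (by fun_prop)]
  refine ENNReal.mul_ne_top (ENNReal.inv_ne_top.2 (h.partitionFunction_ne_zero Λ ξ))
    (ne_top_of_le_ne_top (h.lintegral_exp_mul_boltzmannWeight_lt_top (G := G) (Λ := Λ) l ξ).ne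
      (lintegral_mono fun η => ?_))
  dsimp only
  rw [mul_comm]
  gcongr
  exact Finset.single_le_sum (f := fun x => |glue Λ η ξ x| ^ p) (fun _ _ => by positivity) hx

/-- The recursive estimate of the logarithmic moments in a finite volume. -/
theorem IsStable.exists_logMoment_le (h : IsStable W V p I J)
    (hθ : 0 < θ) (hp : p = 2 + 2 / θ) {l κ : ℝ} (hl : 0 < l) (hκ : 0 < κ) (hκl : κ ≤ l) :
    ∃ C : ℝ, 0 ≤ C ∧ ∀ (Λ : Finset X) (ξ : X → ℝ), ∀ x ∈ Λ,
      logMoment (localGibbs G W V Λ ξ) (fun ω => l * |ω x| ^ p) ≤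
        C * (1 + vertexIndex G θ x) +
        κ / l * (∑ y ∈ G.neighborFinset x with y ∈ Λ,
          logMoment (localGibbs G W V Λ ξ) (fun ω => l * |ω y| ^ p) /
            ((G.degree x : ℝ) * G.degree y)) +
        κ * ∑ y ∈ G.neighborFinset x with y ∉ Λ,
          |ξ y| ^ p / ((G.degree x : ℝ) * G.degree y) := by
  obtain ⟨C, hC0, hC⟩ := h.exists_lintegral_localGibbs_singleton_le (G := G) hθ hp l hκ
  refine ⟨C, hC0, fun Λ ξ x hx => ?_⟩
  have := h.isProbabilityMeasure_localGibbs (G := G) Λ ξ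
  have hnn : ∀ (y : X) (ω : X → ℝ), 0 ≤ l * |ω y| ^ p := fun y ω => by positivity
  obtain ⟨E, hE⟩ : ∃ E : ℝ, E = C * (1 + vertexIndex G θ x) +
      κ * ∑ y ∈ G.neighborFinset x with y ∉ Λ,
        |ξ y| ^ p / ((G.degree x : ℝ) * G.degree y) := ⟨_, rfl⟩
  have h1 : ∫⁻ ω, ENNReal.ofReal (Real.exp (l * |ω x| ^ p)) ∂localGibbs G W V Λ ξ ≤
      ENNReal.ofReal (Real.exp E) * ∫⁻ ω, ENNReal.ofReal (Real.exp
        (∑ y ∈ G.neighborFinset x with y ∈ Λ,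
          κ / l * ((G.degree x : ℝ) * G.degree y)⁻¹ * (l * |ω y| ^ p)))
        ∂localGibbs G W V Λ ξ := by
    -- By consistency the spin at `x` is first averaged given all others, which brings in the
    -- one-point estimate; neighbours outside `Λ` are frozen at `ξ`.
    rw [← h.lintegral_lintegral_localGibbs (Finset.singleton_subset_iff.2 hx) ξ
      (f := fun ω => ENNReal.ofReal (Real.exp (l * |ω x| ^ p))) (by fun_prop),
      ← lintegral_const_mul' _ _ ENNReal.ofReal_ne_top]
    refine h.lintegral_localGibbs_mono
      (h.measurable_lintegral_localGibbs {x} (by fun_prop)) (by fun_prop) fun ω hω => ?_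
    refine (hC x ω).trans (le_of_eq ?_)
    rw [← ENNReal.ofReal_mul (Real.exp_pos _).le, ← Real.exp_add, hE,
      ← Finset.sum_filter_add_sum_filter_not (G.neighborFinset x) (fun y => y ∈ Λ)]
    have e1 : ∑ y ∈ G.neighborFinset x with y ∉ Λ,
        |ω y| ^ p / ((G.degree x : ℝ) * G.degree y) =
        ∑ y ∈ G.neighborFinset x with y ∉ Λ, |ξ y| ^ p / ((G.degree x : ℝ) * G.degree y) :=
      Finset.sum_congr rfl fun y hy => by rw [hω y (Finset.mem_filter.1 hy).2]
    have e2 : ∑ y ∈ G.neighborFinset x with y ∈ Λ,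
        κ / l * ((G.degree x : ℝ) * G.degree y)⁻¹ * (l * |ω y| ^ p) =
        κ * ∑ y ∈ G.neighborFinset x with y ∈ Λ,
          |ω y| ^ p / ((G.degree x : ℝ) * G.degree y) := by
      rw [Finset.mul_sum]
      refine Finset.sum_congr rfl fun y _ => ?_
      rw [div_eq_mul_inv (|ω y| ^ p)]
      field_simp
    rw [e1, e2]
    congr 2
    ring
  -- Hölder applies because the coefficients sum to at most `κ / l ≤ 1`.
  have h2 := lintegral_exp_sum_le (ν := localGibbs G W V Λ ξ)
    (s := {y ∈ G.neighborFinset x | y ∈ Λ}) (g := fun y ω => l * |ω y| ^ p)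
    (c := fun y => κ / l * ((G.degree x : ℝ) * G.degree y)⁻¹)
    (fun y _ => hnn y) (fun y _ => by fun_prop)
    (fun y hy => h.lintegral_exp_rpow_ne_top hl.le (Finset.mem_filter.1 hy).2 ξ)
    (fun y _ => by positivity) (by
      rw [← Finset.mul_sum]
      have e1 : ∑ y ∈ G.neighborFinset x with y ∈ Λ, ((G.degree x : ℝ) * G.degree y)⁻¹ ≤ 1 :=
        (Finset.sum_le_sum_of_subset_of_nonneg (Finset.filter_subset _ _)
          fun _ _ _ => by positivity).trans (sum_neighborFinset_inv_le_one x)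
      exact mul_le_one₀ ((div_le_one hl).2 hκl) (Finset.sum_nonneg fun _ _ => by positivity) e1)
  have h3 := h1.trans (mul_le_mul' le_rfl h2)
  rw [← ofReal_exp_logMoment (hnn x) (h.lintegral_exp_rpow_ne_top hl.le hx ξ),
    ← ENNReal.ofReal_mul (Real.exp_pos _).le, ← Real.exp_add,
    ENNReal.ofReal_le_ofReal_iff (Real.exp_pos _).le, Real.exp_le_exp, hE] at h3
  have h4 : ∑ y ∈ G.neighborFinset x with y ∈ Λ, κ / l * ((G.degree x : ℝ) * G.degree y)⁻¹ *
      logMoment (localGibbs G W V Λ ξ) (fun ω => l * |ω y| ^ p) =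
      κ / l * ∑ y ∈ G.neighborFinset x with y ∈ Λ,
        logMoment (localGibbs G W V Λ ξ) (fun ω => l * |ω y| ^ p) /
          ((G.degree x : ℝ) * G.degree y) := by
    rw [Finset.mul_sum]
    exact Finset.sum_congr rfl fun y _ => by rw [div_eq_mul_inv (logMoment _ _)]; ring
  rw [h4] at h3
  linarith

/-- Weighted summability of the logarithmic moments, uniformly in the volume. -/
theorem IsStable.exists_sum_logMoment_le (h : IsStable W V p I J) (hG : G.Connected)
    (hα : 0 < α) (hθ : 0 < θ) (hp : p = 2 + 2 / θ) (hsum : graphSum G o α θ < ⊤)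
    {l : ℝ} (hl : 0 < l) :
    ∃ C : ℝ, ∀ (Λ : Finset X) (ξ : X → ℝ) (T : ℝ),
      (∀ F : Finset X, Disjoint F Λ → ∑ y ∈ F, |ξ y| ^ p * weight G o α y ≤ T) →
      ∑ x ∈ Λ, weight G o α x * logMoment (localGibbs G W V Λ ξ) (fun ω => l * |ω x| ^ p) ≤
        C + l * T := by
  obtain ⟨M, -, hM⟩ := exists_sum_weight_le hG hθ hsum
  -- With `κ e^α = l/2` the neighbour term contributes at most half of the sum being estimated.
  obtain ⟨κ, hκe⟩ : ∃ κ : ℝ, κ = l * Real.exp (-α) / 2 := ⟨_, rfl⟩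
  have hκ : 0 < κ := hκe ▸ by positivity
  have hκα : κ * Real.exp α = l / 2 := by
    rw [hκe, show l * Real.exp (-α) / 2 * Real.exp α = l * (Real.exp (-α) * Real.exp α) / 2 by ring,
      ← Real.exp_add]
    simp
  have hκl : κ ≤ l := by
    have : Real.exp (-α) ≤ 1 := Real.exp_le_one_iff.2 (by linarith)
    rw [hκe]
    nlinarith
  obtain ⟨C, hC0, hC⟩ := h.exists_logMoment_le (G := G) hθ hp hl hκ hκl
  -- The final inequality is `S ≤ 2CM + S/2 + lT/2`; solving for `S` doubles the constants.
  refine ⟨4 * C * M, fun Λ ξ T hT => ?_⟩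
  have := h.isProbabilityMeasure_localGibbs (G := G) Λ ξ
  set N : X → ℝ := fun x => logMoment (localGibbs G W V Λ ξ) (fun ω => l * |ω x| ^ p) with hN
  have hN0 : ∀ x, 0 ≤ N x := fun x => logMoment_nonneg fun ω => by positivity
  have hw : ∀ x : X, 0 < weight G o α x := fun x => weight_pos x
  obtain ⟨S, hS⟩ : ∃ S, S = ∑ x ∈ Λ, weight G o α x * N x := ⟨_, rfl⟩
  -- The weight moves from `x` to its neighbour `y` at the price `e^α`, after which the column sums
  -- of the kernel apply. It serves both interior and boundary neighbours.
  have transfer : ∀ (φ : X → ℝ), (∀ x, 0 ≤ φ x) → ∀ B : Finset X, ∀ (P : X → Prop) [DecidablePred P],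
      (∀ x ∈ Λ, ∀ y ∈ G.neighborFinset x, P y ↔ y ∈ B) →
      ∑ x ∈ Λ, weight G o α x * ∑ y ∈ G.neighborFinset x with P y,
        φ y / ((G.degree x : ℝ) * G.degree y) ≤
      Real.exp α * ∑ y ∈ B, weight G o α y * φ y := by
    intro φ hφ B P _ hP
    calc ∑ x ∈ Λ, weight G o α x * ∑ y ∈ G.neighborFinset x with P y,
          φ y / ((G.degree x : ℝ) * G.degree y)
        ≤ ∑ x ∈ Λ, ∑ y ∈ G.neighborFinset x with y ∈ B,
          (Real.exp α * weight G o α y * φ y) / ((G.degree x : ℝ) * G.degree y) := by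
          refine Finset.sum_le_sum fun x hx => ?_
          rw [Finset.filter_congr (hP x hx), Finset.mul_sum]
          refine Finset.sum_le_sum fun y hy => ?_
          have hxy : G.Adj x y := by simpa using (Finset.mem_filter.1 hy).1
          rw [← mul_div_assoc]
          have := mul_le_mul_of_nonneg_right (weight_le_of_adj (o := o) hG hα hxy) (hφ y)
          gcongr
      _ ≤ ∑ y ∈ B, Real.exp α * weight G o α y * φ y :=
          sum_sum_neighborFinset_le
            (fun y => mul_nonneg (mul_pos (Real.exp_pos _) (hw y)).le (hφ y)) Λ B
      _ = _ := by
          rw [Finset.mul_sum]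
          exact Finset.sum_congr rfl fun y _ => by ring
  have t1 := transfer N hN0 Λ (fun y => y ∈ Λ) fun _ _ _ _ => Iff.rfl
  have t2 := transfer (fun y => |ξ y| ^ p) (fun y => by positivity) (ball G Λ \ Λ)
    (fun y => y ∉ Λ) fun x hx y hy => by
      simp [neighborFinset_subset_ball hx hy]
  have t3 := hT (ball G Λ \ Λ) Finset.sdiff_disjoint
  have t3' : ∑ y ∈ ball G Λ \ Λ, weight G o α y * |ξ y| ^ p ≤ T := by
    simpa only [mul_comm (weight G o α _)] using t3
  rw [← hS] at t1
  have h1 : S ≤ ∑ x ∈ Λ, weight G o α x * (C * (1 + vertexIndex G θ x) +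
        κ / l * (∑ y ∈ G.neighborFinset x with y ∈ Λ,
          N y / ((G.degree x : ℝ) * G.degree y)) +
        κ * ∑ y ∈ G.neighborFinset x with y ∉ Λ,
          |ξ y| ^ p / ((G.degree x : ℝ) * G.degree y)) := by
    rw [hS]
    exact Finset.sum_le_sum fun x hx => mul_le_mul_of_nonneg_left (hC Λ ξ x hx) (hw x).le
  have h2 : ∀ a b : X → ℝ, ∑ x ∈ Λ, weight G o α x * (C * (1 + vertexIndex G θ x) +
        κ / l * a x + κ * b x) = C * (∑ x ∈ Λ, weight G o α x +
          ∑ x ∈ Λ, vertexIndex G θ x * weight G o α x) +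
        κ / l * (∑ x ∈ Λ, weight G o α x * a x) + κ * ∑ x ∈ Λ, weight G o α x * b x := by
    intro a b
    simp only [Finset.mul_sum, ← Finset.sum_add_distrib]
    exact Finset.sum_congr rfl fun x _ => by ring
  rw [h2] at h1
  have h3 := mul_le_mul_of_nonneg_left (add_le_add (hM Λ).1 (hM Λ).2) hC0
  have h4 := mul_le_mul_of_nonneg_left t1 (div_pos hκ hl).le
  have h5 := mul_le_mul_of_nonneg_left (t2.trans (mul_le_mul_of_nonneg_left t3'
    (Real.exp_pos α).le)) hκ.le
  have h6 : κ / l * (Real.exp α * S) = S / 2 := by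
    rw [show κ / l * (Real.exp α * S) = κ * Real.exp α / l * S by ring, hκα]
    field_simp
  have h7 : κ * (Real.exp α * T) = l * T / 2 := by rw [← mul_assoc, hκα]; ring
  rw [h6] at h4
  rw [h7] at h5
  rw [← hS]
  linarith

/-- The normalized weights `w_α / M` sum to at most 1, so Hölder reduces the joint moment to
single-spin logarithmic moments at parameter `l M`. -/
theorem IsStable.exists_lintegral_exp_sum_le (h : IsStable W V p I J) (hG : G.Connected)
    (hα : 0 < α) (hθ : 0 < θ) (hp : p = 2 + 2 / θ) (hsum : graphSum G o α θ < ⊤)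
    {l : ℝ} (hl : 0 < l) :
    ∃ C : ℝ, ∀ (Λ : Finset X) (ξ : X → ℝ) (T : ℝ),
      (∀ F : Finset X, Disjoint F Λ → ∑ y ∈ F, |ξ y| ^ p * weight G o α y ≤ T) →
      ∫⁻ ω, ENNReal.ofReal (Real.exp (l * ∑ x ∈ Λ, |ω x| ^ p * weight G o α x))
        ∂localGibbs G W V Λ ξ ≤ ENNReal.ofReal (Real.exp (C + l * T)) := by
  obtain ⟨M, hM0, hM⟩ := exists_sum_weight_le hG hθ hsum
  obtain ⟨C, hC⟩ := h.exists_sum_logMoment_le hG hα hθ hp hsum (mul_pos hl hM0)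
  refine ⟨C / M, fun Λ ξ T hT => ?_⟩
  have := h.isProbabilityMeasure_localGibbs (G := G) Λ ξ
  have h1 := lintegral_exp_sum_le (ν := localGibbs G W V Λ ξ)
    (s := Λ) (g := fun x ω => l * M * |ω x| ^ p) (c := fun x => weight G o α x / M)
    (fun y _ ω => by positivity) (fun y _ => by fun_prop)
    (fun y hy => h.lintegral_exp_rpow_ne_top (by positivity) hy ξ)
    (fun y _ => (div_pos (weight_pos y) hM0).le) (by
      rw [← Finset.sum_div]
      exact (div_le_one hM0).2 (hM Λ).1)
  have h2 : ∀ ω : X → ℝ, ∑ x ∈ Λ, weight G o α x / M * (l * M * |ω x| ^ p) =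
      l * ∑ x ∈ Λ, |ω x| ^ p * weight G o α x := fun ω => by
    rw [Finset.mul_sum]
    refine Finset.sum_congr rfl fun x _ => ?_
    field_simp
  simp only [h2] at h1
  refine h1.trans (ENNReal.ofReal_le_ofReal (Real.exp_le_exp.2 ?_))
  have h3 : ∀ a : X → ℝ, ∑ x ∈ Λ, weight G o α x / M * a x =
      (∑ x ∈ Λ, weight G o α x * a x) / M := fun a => by
    rw [Finset.sum_div]
    exact Finset.sum_congr rfl fun x _ => by ring
  rw [h3, div_le_iff₀ hM0]
  have h4 := hC Λ ξ T hT
  have h5 : (C / M + l * T) * M = C + l * M * T := by field_simp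
  linarith

end VolumeEstimate

/-! ### Weak topology, tightness -/

section Tight

open scoped BoundedContinuousFunction NNReal

theorem continuous_lintegral_of_le {Ω : Type*} [TopologicalSpace Ω] [MeasurableSpace Ω]
    [OpensMeasurableSpace Ω] {f : Ω → ℝ≥0∞} (hf : Continuous f) {M : ℝ≥0∞} (hM : M ≠ ⊤)
    (hfM : ∀ ω, f ω ≤ M) :
    Continuous fun μ : ProbabilityMeasure Ω => ∫⁻ ω, f ω ∂(μ : Measure Ω) := by
  have hft : ∀ ω, f ω ≠ ⊤ := fun ω => ne_top_of_le_ne_top hM (hfM ω)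
  have hc : Continuous fun ω => (f ω).toNNReal :=
    ENNReal.continuousOn_toNNReal.comp_continuous hf hft
  let g : Ω →ᵇ ℝ≥0 := BoundedContinuousFunction.mkOfBound ⟨fun ω => (f ω).toNNReal, hc⟩
    M.toNNReal fun x y => by
      rw [NNReal.dist_eq]
      have h1 := ENNReal.toNNReal_mono hM (hfM x)
      have h2 := ENNReal.toNNReal_mono hM (hfM y)
      have h3 : ((f x).toNNReal : ℝ) ≤ M.toNNReal := by exact_mod_cast h1
      have h4 : ((f y).toNNReal : ℝ) ≤ M.toNNReal := by exact_mod_cast h2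
      have h5 := (f x).toNNReal.coe_nonneg
      have h6 := (f y).toNNReal.coe_nonneg
      exact abs_le.2 ⟨by simp only [ContinuousMap.coe_mk]; linarith,
        by simp only [ContinuousMap.coe_mk]; linarith⟩
  have hg : ∀ ω, (g ω : ℝ≥0∞) = f ω := fun ω => ENNReal.coe_toNNReal (hft ω)
  simpa only [hg] using ProbabilityMeasure.continuous_lintegral_boundedContinuousFunction g

/-- A family of laws on `ℝ ^ X` with uniformly bounded first moments is tight. -/
theorem isTightMeasureSet_of_lintegral_le {X : Type*} [Countable X]
    {S : Set (ProbabilityMeasure (X → ℝ))} {B : X → ℝ≥0∞} (hB : ∀ x, B x ≠ ⊤)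
    (hS : ∀ μ ∈ S, ∀ x, ∫⁻ ω, ENNReal.ofReal |ω x| ∂(μ : Measure (X → ℝ)) ≤ B x) :
    IsTightMeasureSet {((μ : ProbabilityMeasure (X → ℝ)) : Measure (X → ℝ)) | μ ∈ S} := by
  rw [isTightMeasureSet_iff_exists_isCompact_measure_compl_le]
  intro ε hε
  -- `ε` is distributed over the countably many coordinates; Markov's inequality selects an interval
  -- for each, and their product is compact by Tychonoff.
  obtain ⟨δ, hδ0, hδ⟩ := ENNReal.exists_pos_sum_of_countable' hε.ne' X
  have hr : ∀ x, ∃ r : ℝ, 0 < r ∧ B x ≤ δ x * ENNReal.ofReal r := fun x => by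
    rcases eq_or_ne (δ x) ⊤ with h | h
    · exact ⟨1, one_pos, by simp [h]⟩
    · have ht : B x / δ x ≠ ⊤ := ENNReal.div_ne_top (hB x) (hδ0 x).ne'
      refine ⟨(B x / δ x).toReal + 1, by positivity, ?_⟩
      rw [mul_comm, ← ENNReal.div_le_iff (hδ0 x).ne' h, ENNReal.ofReal_add ENNReal.toReal_nonneg
        zero_le_one, ENNReal.ofReal_toReal ht]
      exact le_self_add
  choose r hr0 hr using hr
  refine ⟨Set.univ.pi fun x => Set.Icc (-r x) (r x), isCompact_univ_pi fun x => isCompact_Icc, ?_⟩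
  rintro _ ⟨μ, hμ, rfl⟩
  have hsub : (Set.univ.pi fun x => Set.Icc (-r x) (r x))ᶜ ⊆
      ⋃ x, {ω : X → ℝ | ENNReal.ofReal (r x) ≤ ENNReal.ofReal |ω x|} := fun ω hω => by
    simp only [Set.mem_compl_iff, Set.mem_univ_pi, not_forall, Set.mem_Icc, ← abs_le,
      not_le] at hω
    obtain ⟨x, hx⟩ := hω
    exact Set.mem_iUnion.2 ⟨x, ENNReal.ofReal_le_ofReal hx.le⟩
  refine (measure_mono hsub).trans ((measure_iUnion_le _).trans
    ((ENNReal.tsum_le_tsum fun x => ?_).trans hδ.le))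
  have h1 := mul_meas_ge_le_lintegral (μ := (μ : Measure (X → ℝ)))
    (f := fun ω : X → ℝ => ENNReal.ofReal |ω x|) (by fun_prop) (ENNReal.ofReal (r x))
  have h2 := h1.trans ((hS μ hμ x).trans (hr x))
  rw [mul_comm (δ x)] at h2
  exact (ENNReal.mul_le_mul_iff_right (ENNReal.ofReal_pos.2 (hr0 x)).ne'
    ENNReal.ofReal_ne_top).1 h2

end Tight

/-! ### Exponential moments of the weighted norm -/

section ExpNorm

variable {X : Type*} {G : SimpleGraph X} {o : X} {p α : ℝ}

/-- The exponential `exp (l ‖ω‖ ^ p)` of the weighted norm. -/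
def expNorm (G : SimpleGraph X) (o : X) (p α l : ℝ) (ω : X → ℝ) : ℝ≥0∞ :=
  EReal.exp ((ENNReal.ofReal l * wnorm G o p α ω ^ p : ℝ≥0∞) : EReal)

/-- The truncation at level `N` of the contribution of the vertices of `Λ` to `expNorm`. -/
def truncExpNorm (G : SimpleGraph X) (o : X) (p α l : ℝ) (Λ : Finset X) (N : ℕ) (ω : X → ℝ) :
    ℝ≥0∞ :=
  min (ENNReal.ofReal (Real.exp (l * ∑ x ∈ Λ, |ω x| ^ p * weight G o α x))) N

theorem wnorm_rpow (hp : 0 < p) (ω : X → ℝ) :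
    wnorm G o p α ω ^ p = ∑' x, ENNReal.ofReal (|ω x| ^ p * weight G o α x) := by
  rw [wnorm, ← ENNReal.rpow_mul, one_div_mul_cancel hp.ne', ENNReal.rpow_one]

theorem ofReal_exp_sum_eq {l : ℝ} (hl : 0 ≤ l) (Λ : Finset X) (ω : X → ℝ) :
    ENNReal.ofReal (Real.exp (l * ∑ x ∈ Λ, |ω x| ^ p * weight G o α x)) =
      EReal.exp ((ENNReal.ofReal l *
        ∑ x ∈ Λ, ENNReal.ofReal (|ω x| ^ p * weight G o α x) : ℝ≥0∞) : EReal) := by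
  have h0 : ∀ x ∈ Λ, 0 ≤ |ω x| ^ p * weight G o α x := fun x _ =>
    mul_nonneg (by positivity) (weight_pos x).le
  rw [← ENNReal.ofReal_sum_of_nonneg h0, ← ENNReal.ofReal_mul hl, EReal.coe_ennreal_ofReal,
    max_eq_left (mul_nonneg hl (Finset.sum_nonneg h0)), EReal.exp_coe]

theorem ofReal_exp_sum_le_expNorm (hp : 0 < p) {l : ℝ} (hl : 0 ≤ l) (Λ : Finset X) (ω : X → ℝ) :
    ENNReal.ofReal (Real.exp (l * ∑ x ∈ Λ, |ω x| ^ p * weight G o α x)) ≤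
      expNorm G o p α l ω := by
  rw [ofReal_exp_sum_eq hl, expNorm, wnorm_rpow hp]
  refine EReal.exp_monotone (EReal.coe_ennreal_le_coe_ennreal_iff.2 ?_)
  exact mul_le_mul' le_rfl (ENNReal.sum_le_tsum Λ)

theorem tendsto_truncExpNorm (hp : 0 < p) {l : ℝ} (hl : 0 ≤ l) (ω : X → ℝ) :
    Tendsto (fun z : Finset X × ℕ => truncExpNorm G o p α l z.1 z.2 ω) (atTop ×ˢ atTop)
      (𝓝 (expNorm G o p α l ω)) := by
  have h1 : Tendsto (fun Λ : Finset X =>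
      ENNReal.ofReal (Real.exp (l * ∑ x ∈ Λ, |ω x| ^ p * weight G o α x))) atTop
      (𝓝 (expNorm G o p α l ω)) := by
    simp only [ofReal_exp_sum_eq hl, expNorm, wnorm_rpow hp]
    refine (ENNReal.continuous_exp.tendsto _).comp
      ((continuous_coe_ennreal_ereal.tendsto _).comp ?_)
    exact ENNReal.Tendsto.const_mul ENNReal.summable.hasSum (Or.inr ENNReal.ofReal_ne_top)
  have h2 := (h1.comp tendsto_fst).min (ENNReal.tendsto_nat_nhds_top.comp
    (tendsto_snd (f := (atTop : Filter (Finset X)))))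
  rwa [min_eq_left le_top] at h2

theorem truncExpNorm_le_expNorm (hp : 0 < p) {l : ℝ} (hl : 0 ≤ l) (Λ : Finset X) (N : ℕ)
    (ω : X → ℝ) : truncExpNorm G o p α l Λ N ω ≤ expNorm G o p α l ω :=
  (min_le_left _ _).trans (ofReal_exp_sum_le_expNorm hp hl Λ ω)

theorem continuous_truncExpNorm (hp : 0 < p) (l : ℝ) (Λ : Finset X) (N : ℕ) :
    Continuous (truncExpNorm G o p α l Λ N) := by
  have : Continuous fun ω : X → ℝ => l * ∑ x ∈ Λ, |ω x| ^ p * weight G o α x := by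
    refine continuous_const.mul (continuous_finsetSum _ fun x _ => Continuous.mul ?_
      continuous_const)
    exact (continuous_abs.comp (continuous_apply x)).rpow_const fun _ => Or.inr hp.le
  exact (ENNReal.continuous_ofReal.comp (Real.continuous_exp.comp this)).min continuous_const

variable [Countable X]

theorem measurable_wnorm : Measurable (wnorm G o p α) := by
  unfold wnorm
  fun_prop

/-- Fatou's lemma along growing `Λ` and `N` reduces the moment bound to bounded continuous functions
of finitely many spins, which weak convergence can test. -/
theorem lintegral_expNorm_le_iff (hp : 0 < p) {l : ℝ} (hl : 0 ≤ l) {μ : Measure (X → ℝ)}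
    {B : ℝ≥0∞} : ∫⁻ ω, expNorm G o p α l ω ∂μ ≤ B ↔
      ∀ (Λ : Finset X) (N : ℕ), ∫⁻ ω, truncExpNorm G o p α l Λ N ω ∂μ ≤ B := by
  refine ⟨fun h Λ N => (lintegral_mono fun ω =>
    truncExpNorm_le_expNorm hp hl Λ N ω).trans h, fun h => ?_⟩
  calc ∫⁻ ω, expNorm G o p α l ω ∂μ
      = ∫⁻ ω, liminf (fun z : Finset X × ℕ => truncExpNorm G o p α l z.1 z.2 ω)
          (atTop ×ˢ atTop) ∂μ :=
        lintegral_congr fun ω => (tendsto_truncExpNorm hp hl ω).liminf_eq.symm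
    _ ≤ liminf (fun z : Finset X × ℕ => ∫⁻ ω, truncExpNorm G o p α l z.1 z.2 ω ∂μ)
          (atTop ×ˢ atTop) :=
        lintegral_liminf_le fun z => (continuous_truncExpNorm hp l z.1 z.2).measurable
    _ ≤ B := liminf_le_of_frequently_le' (Frequently.of_forall fun z => h z.1 z.2)

/-- The laws with exponential moment of the weighted norm bounded by `B`. -/
def expMomentSet (G : SimpleGraph X) (o : X) (p α l : ℝ) (B : ℝ≥0∞) :
    Set (ProbabilityMeasure (X → ℝ)) :=
  {μ | ∫⁻ ω, expNorm G o p α l ω ∂(μ : Measure (X → ℝ)) ≤ B}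

theorem isClosed_expMomentSet (hp : 0 < p) {l : ℝ} (hl : 0 ≤ l) (B : ℝ≥0∞) :
    IsClosed (expMomentSet G o p α l B) := by
  have : expMomentSet G o p α l B = ⋂ (Λ : Finset X) (N : ℕ),
      {μ : ProbabilityMeasure (X → ℝ) |
        ∫⁻ ω, truncExpNorm G o p α l Λ N ω ∂(μ : Measure (X → ℝ)) ≤ B} := by
    ext μ
    simp [expMomentSet, lintegral_expNorm_le_iff hp hl]
  rw [this]
  refine isClosed_iInter fun Λ => isClosed_iInter fun N => ?_
  exact isClosed_le (continuous_lintegral_of_le (continuous_truncExpNorm hp l Λ N)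
    (ENNReal.natCast_ne_top N) fun ω => min_le_right _ _) continuous_const

theorem isCompact_expMomentSet (hp : 2 ≤ p) {l : ℝ} (hl : 0 < l) {B : ℝ≥0∞} (hB : B ≠ ⊤) :
    IsCompact (expMomentSet G o p α l B) := by
  have hp0 : 0 < p := by linarith
  have hcl := isClosed_expMomentSet (G := G) (o := o) (α := α) hp0 hl.le B
  rw [← hcl.closure_eq]
  -- Prokhorov's theorem: with `c = l w_α(x)`, `|u| ≤ (2 + 1/c) exp(c|u|^p)` bounds all first
  -- moments uniformly on the set.
  refine isCompact_closure_of_isTightMeasureSet (isTightMeasureSet_of_lintegral_le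
    (B := fun x => ENNReal.ofReal (2 + (l * weight G o α x)⁻¹) * B)
    (fun x => ENNReal.mul_ne_top ENNReal.ofReal_ne_top hB) fun μ hμ x => ?_)
  refine le_trans ?_ (mul_le_mul' le_rfl hμ)
  rw [← lintegral_const_mul' _ _ ENNReal.ofReal_ne_top]
  refine lintegral_mono fun ω => ?_
  refine le_trans ?_ (mul_le_mul' le_rfl (ofReal_exp_sum_le_expNorm hp0 hl.le {x} ω))
  have hc : 0 < l * weight G o α x := mul_pos hl (weight_pos x)
  rw [Finset.sum_singleton, ← ENNReal.ofReal_mul (by positivity)]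
  refine ENNReal.ofReal_le_ofReal ?_
  have h1 := sq_le_one_add_rpow hp (ω x)
  rw [← sq_abs] at h1
  obtain ⟨t, ht⟩ : ∃ t, t = |ω x| ^ p := ⟨_, rfl⟩
  have ht0 : 0 ≤ t := ht ▸ by positivity
  rw [← ht] at h1 ⊢
  obtain ⟨c, hce⟩ : ∃ c, c = l * weight G o α x := ⟨_, rfl⟩
  rw [← hce] at hc ⊢
  rw [show l * (t * weight G o α x) = c * t by rw [hce]; ring]
  have h2 := Real.add_one_le_exp (c * t)
  have h3 : c⁻¹ * (c * t + 1) ≤ c⁻¹ * Real.exp (c * t) :=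
    mul_le_mul_of_nonneg_left h2 (inv_pos.2 hc).le
  have h4 : c⁻¹ * (c * t + 1) = t + c⁻¹ := by field_simp
  have h5 : 0 ≤ c * t := by positivity
  have h6 : 0 < c⁻¹ := inv_pos.2 hc
  have h7 := sq_nonneg (|ω x| - 1)
  nlinarith

end ExpNorm

/-! ### Gibbs measures -/

section Gibbs

open scoped Classical BoundedContinuousFunction NNReal

variable {X : Type*} [Countable X] {G : SimpleGraph X} [G.LocallyFinite] {W : ℝ → ℝ → ℝ}
  {V : ℝ → ℝ} {Λ : Finset X} {o : X} {p I J θ α : ℝ}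

theorem IsStable.mem_gibbsMeasures_iff_bind (h : IsStable W V p I J)
    (μ : ProbabilityMeasure (X → ℝ)) :
    μ ∈ gibbsMeasures G W V ↔ ∀ Λ : Finset X, Λ.Nonempty →
      (μ : Measure (X → ℝ)).bind (localGibbs G W V Λ) = μ := by
  refine forall_congr' fun Λ => imp_congr_right fun _ => ?_
  have hm := (h.measurable_localGibbs (G := G) Λ).aemeasurable (μ := (μ : Measure (X → ℝ)))
  constructor
  · intro hA
    ext A hAm
    rw [Measure.bind_apply hAm hm, hA A hAm]
  · intro hA A hAm
    conv_lhs => rw [← hA]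
    rw [Measure.bind_apply hAm hm]

theorem IsStable.lintegral_of_mem_gibbsMeasures (h : IsStable W V p I J)
    {μ : ProbabilityMeasure (X → ℝ)} (hμ : μ ∈ gibbsMeasures G W V) (hΛ : Λ.Nonempty)
    {f : (X → ℝ) → ℝ≥0∞} (hf : Measurable f) :
    ∫⁻ ω, f ω ∂(μ : Measure (X → ℝ)) =
      ∫⁻ ξ, ∫⁻ ω, f ω ∂localGibbs G W V Λ ξ ∂(μ : Measure (X → ℝ)) := by
  conv_lhs => rw [← (h.mem_gibbsMeasures_iff_bind μ).1 hμ Λ hΛ]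
  rw [Measure.lintegral_bind (h.measurable_localGibbs Λ).aemeasurable hf.aemeasurable]

/-- Bounded continuous functions determine finite measures. In this form both sides of the DLR
equation are continuous in `μ`, so it survives weak limits. -/
theorem IsStable.mem_gibbsMeasures_iff_forall_boundedContinuous (h : IsStable W V p I J)
    (μ : ProbabilityMeasure (X → ℝ)) :
    μ ∈ gibbsMeasures G W V ↔ ∀ Λ : Finset X, Λ.Nonempty → ∀ f : (X → ℝ) →ᵇ ℝ≥0,
      ∫⁻ ω, f ω ∂(μ : Measure (X → ℝ)) =
        ∫⁻ ξ, ∫⁻ ω, f ω ∂localGibbs G W V Λ ξ ∂(μ : Measure (X → ℝ)) := by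
  refine ⟨fun hμ Λ hΛ f => h.lintegral_of_mem_gibbsMeasures hμ hΛ (by fun_prop), fun hf => ?_⟩
  refine (h.mem_gibbsMeasures_iff_bind μ).2 fun Λ hΛ => ?_
  refine (ext_of_forall_lintegral_eq_of_IsFiniteMeasure fun f => ?_).symm
  rw [Measure.lintegral_bind (h.measurable_localGibbs Λ).aemeasurable
    (by fun_prop), hf Λ hΛ f]

theorem exists_le_of_boundedContinuous {Ω : Type*} [TopologicalSpace Ω] (f : Ω →ᵇ ℝ≥0) :
    ∃ M : ℝ≥0∞, M ≠ ⊤ ∧ ∀ ω, (f ω : ℝ≥0∞) ≤ M :=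
  ⟨nndist 0 f, ENNReal.coe_ne_top, fun ω => by
    exact_mod_cast f.apply_le_nndist_zero ω⟩

theorem IsStable.continuous_lintegral_lintegral_localGibbs (h : IsStable W V p I J)
    (Λ : Finset X) (f : (X → ℝ) →ᵇ ℝ≥0) :
    Continuous fun μ : ProbabilityMeasure (X → ℝ) =>
      ∫⁻ ξ, ∫⁻ ω, f ω ∂localGibbs G W V Λ ξ ∂(μ : Measure (X → ℝ)) := by
  obtain ⟨M, hM, hfM⟩ := exists_le_of_boundedContinuous f
  refine continuous_lintegral_of_le (h.continuous_lintegral_localGibbs Λ (by fun_prop) hM hfM) hM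
    fun ξ => ?_
  have := h.isProbabilityMeasure_localGibbs (G := G) Λ ξ
  exact (lintegral_mono fun ω => hfM ω).trans (by simp)

theorem IsStable.isClosed_gibbsMeasures (h : IsStable W V p I J) :
    IsClosed (gibbsMeasures G W V) := by
  have : gibbsMeasures G W V = ⋂ (Λ : Finset X) (_ : Λ.Nonempty) (f : (X → ℝ) →ᵇ ℝ≥0),
      {μ : ProbabilityMeasure (X → ℝ) | ∫⁻ ω, f ω ∂(μ : Measure (X → ℝ)) =
        ∫⁻ ξ, ∫⁻ ω, f ω ∂localGibbs G W V Λ ξ ∂(μ : Measure (X → ℝ))} := by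
    ext μ
    simp only [h.mem_gibbsMeasures_iff_forall_boundedContinuous μ, Set.mem_iInter,
      Set.mem_ofPred_eq]
  rw [this]
  refine isClosed_iInter fun Λ => isClosed_iInter fun _ => isClosed_iInter fun f => ?_
  exact isClosed_eq (ProbabilityMeasure.continuous_lintegral_boundedContinuousFunction f)
    (h.continuous_lintegral_lintegral_localGibbs Λ f)

/-- The a priori bound on the exponential moments of tempered Gibbs measures and of the local
Gibbs measures with zero boundary condition. -/
theorem IsStable.exists_expMoment_le (h : IsStable W V p I J) (hG : G.Connected)
    (hα : 0 < α) (hθ : 0 < θ) (hp : p = 2 + 2 / θ) (hsum : graphSum G o α θ < ⊤)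
    {l : ℝ} (hl : 0 < l) :
    ∃ C : ℝ, (∀ μ ∈ temperedGibbs G W V o p α,
        ∫⁻ ω, expNorm G o p α l ω ∂(μ : Measure (X → ℝ)) ≤ ENNReal.ofReal (Real.exp C)) ∧
      ∀ Λ : Finset X, ∫⁻ ω, expNorm G o p α l ω ∂localGibbs G W V Λ 0 ≤
        ENNReal.ofReal (Real.exp C) := by
  have hp0 : 0 < p := by linarith [h.two_lt]
  obtain ⟨C, hC⟩ := h.exists_lintegral_exp_sum_le hG hα hθ hp hsum hl
  have hw : ∀ x : X, 0 < weight G o α x := fun x => weight_pos x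
  have hnn : ∀ (ω : X → ℝ) (x : X), 0 ≤ |ω x| ^ p * weight G o α x := fun ω x =>
    mul_nonneg (by positivity) (hw x).le
  refine ⟨C, fun μ hμ => ?_, fun Λ => ?_⟩
  · refine (lintegral_expNorm_le_iff hp0 hl.le).2 fun Δ N => ?_
    set tail : Finset X → (X → ℝ) → ℝ≥0∞ := fun Λ ξ =>
      ∑' y : {y // y ∉ Λ}, ENNReal.ofReal (|ξ y| ^ p * weight G o α y) with htail
    have htm : ∀ Λ, Measurable (tail Λ) := fun Λ => by
      simp only [htail]
      fun_prop
    have hfin : ∀ᵐ ξ ∂(μ : Measure (X → ℝ)),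
        ∑' x, ENNReal.ofReal (|ξ x| ^ p * weight G o α x) ≠ ⊤ := by
      have hmeas : MeasurableSet (weightedLp G o p α) :=
        measurableSet_lt measurable_wnorm measurable_const
      have h1 := (mem_ae_iff_prob_eq_one hmeas).2 hμ.2
      filter_upwards [h1] with ξ hξ
      rw [← wnorm_rpow hp0]
      exact ENNReal.rpow_ne_top_of_nonneg hp0.le hξ.ne
    -- The DLR equation replaces `μ` by the local Gibbs measure in a larger volume, whose boundary
    -- mass is the tail of `ξ`. Including `o` keeps `Λ` nonempty.
    have hbound : ∀ Λ : Finset X, Δ ∪ {o} ⊆ Λ →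
        ∫⁻ ω, truncExpNorm G o p α l Δ N ω ∂(μ : Measure (X → ℝ)) ≤
        ∫⁻ ξ, min (ENNReal.ofReal (Real.exp (C + l * (tail Λ ξ).toReal))) N
          ∂(μ : Measure (X → ℝ)) := by
      intro Λ hΛ
      have hne : Λ.Nonempty := ⟨o, hΛ (by simp)⟩
      rw [h.lintegral_of_mem_gibbsMeasures hμ.1 hne
        (continuous_truncExpNorm hp0 l Δ N).measurable]
      refine lintegral_mono_ae ?_
      filter_upwards [hfin] with ξ hξ
      have := h.isProbabilityMeasure_localGibbs (G := G) Λ ξ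
      refine le_min ?_ ?_
      · have htt : tail Λ ξ ≠ ⊤ := ne_top_of_le_ne_top hξ
          (ENNReal.tsum_comp_le_tsum_of_injective Subtype.val_injective _)
        refine le_trans (lintegral_mono fun ω => (min_le_left _ _).trans ?_)
          (hC Λ ξ (tail Λ ξ).toReal fun F hF => ?_)
        · refine ENNReal.ofReal_le_ofReal (Real.exp_le_exp.2 (mul_le_mul_of_nonneg_left ?_ hl.le))
          exact Finset.sum_le_sum_of_subset_of_nonneg (Finset.union_subset_left hΛ)
            fun x _ _ => hnn ω x
        · rw [← ENNReal.ofReal_le_iff_le_toReal htt,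
            ENNReal.ofReal_sum_of_nonneg fun x _ => hnn ξ x]
          have h1 : ∀ y ∈ F, y ∉ Λ := fun y hy => Finset.disjoint_left.1 hF hy
          rw [← Finset.sum_subtype_of_mem
            (fun y => ENNReal.ofReal (|ξ y| ^ p * weight G o α y)) h1]
          exact ENNReal.sum_le_tsum _
      · exact (lintegral_mono fun ω => min_le_right _ _).trans (by simp)
    -- Temperedness makes the tail vanish almost surely; the truncation at `N` supplies the
    -- dominating function, since `exp(l · tail)` is not known to be integrable.
    have hlim : Tendsto (fun Λ : Finset X =>
        ∫⁻ ξ, min (ENNReal.ofReal (Real.exp (C + l * (tail Λ ξ).toReal))) N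
          ∂(μ : Measure (X → ℝ))) atTop
        (𝓝 (∫⁻ _, min (ENNReal.ofReal (Real.exp C)) N ∂(μ : Measure (X → ℝ)))) := by
      refine tendsto_lintegral_filter_of_dominated_convergence (fun _ => (N : ℝ≥0∞)) ?_ ?_ ?_ ?_
      · refine Eventually.of_forall fun Λ => ?_
        have := htm Λ
        fun_prop
      · exact Eventually.of_forall fun Λ => Eventually.of_forall fun ξ => min_le_right _ _
      · simp
      · filter_upwards [hfin] with ξ hξ
        have h1 : Tendsto (fun Λ => tail Λ ξ) atTop (𝓝 0) :=
          ENNReal.tendsto_tsum_compl_atTop_zero hξ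
        have h2 := (ENNReal.tendsto_toReal ENNReal.zero_ne_top).comp h1
        have h3 : Tendsto (fun Λ => C + l * (tail Λ ξ).toReal) atTop (𝓝 C) := by
          simpa using (h2.const_mul l).const_add C
        exact ((ENNReal.continuous_ofReal.tendsto _).comp
          ((Real.continuous_exp.tendsto _).comp h3)).min tendsto_const_nhds
    have h4 := ge_of_tendsto hlim
      ((eventually_ge_atTop (Δ ∪ {o})).mono fun Λ hΛ => hbound Λ hΛ)
    refine h4.trans ?_
    simp
  · refine (lintegral_expNorm_le_iff hp0 hl.le).2 fun Δ N => ?_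
    have h1 := hC Λ 0 0 fun F _ => by simp [Real.zero_rpow hp0.ne']
    rw [mul_zero, add_zero] at h1
    refine le_trans (h.lintegral_localGibbs_mono
      (continuous_truncExpNorm hp0 l Δ N).measurable (by fun_prop) fun ω hω => ?_) h1
    refine (min_le_left _ _).trans (ENNReal.ofReal_le_ofReal (Real.exp_le_exp.2
      (mul_le_mul_of_nonneg_left ?_ hl.le)))
    calc ∑ x ∈ Δ, |ω x| ^ p * weight G o α x ≤ ∑ x ∈ Δ ∪ Λ, |ω x| ^ p * weight G o α x :=
          Finset.sum_le_sum_of_subset_of_nonneg Finset.subset_union_left fun x _ _ => hnn ω x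
      _ = ∑ x ∈ Λ, |ω x| ^ p * weight G o α x :=
          (Finset.sum_subset Finset.subset_union_right fun x _ hx => by
            simp [hω x hx, Real.zero_rpow hp0.ne']).symm

/-- `expNorm` takes the value `⊤` where the weighted norm is infinite, so a finite integral excludes
such configurations almost surely. -/
theorem IsStable.mem_temperedGibbs_of_expMoment (h : IsStable W V p I J) {l : ℝ} (hl : 0 < l)
    {B : ℝ≥0∞} (hB : B ≠ ⊤) {μ : ProbabilityMeasure (X → ℝ)} (hμ : μ ∈ gibbsMeasures G W V)
    (hμB : μ ∈ expMomentSet G o p α l B) : μ ∈ temperedGibbs G W V o p α := by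
  have hp0 : 0 < p := by linarith [h.two_lt]
  have hmeas : MeasurableSet (weightedLp G o p α) :=
    measurableSet_lt measurable_wnorm measurable_const
  refine ⟨hμ, (mem_ae_iff_prob_eq_one hmeas).1 ?_⟩
  have hm : Measurable (expNorm G o p α l) := by
    have := measurable_wnorm (G := G) (o := o) (p := p) (α := α)
    exact (measurable_coe_ennreal_ereal.comp ((this.pow_const p).const_mul _)).ereal_exp
  filter_upwards [ae_lt_top hm (ne_top_of_le_ne_top hB hμB)] with ω hω
  by_contra hn
  have htop : wnorm G o p α ω = ⊤ := not_lt_top_iff.1 hn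
  refine hω.ne ?_
  rw [expNorm, htop, ENNReal.top_rpow_of_pos hp0, ENNReal.mul_top (ENNReal.ofReal_pos.2 hl).ne']
  rfl

/-- The local Gibbs measures with zero boundary condition stay in a compact moment ball, hence
converge along an ultrafilter finer than `atTop`. Each satisfies the DLR equation for `Δ` once `Δ ⊆
Λ`, and the Feller property carries this to the limit. -/
theorem IsStable.nonempty_gibbsMeasures_inter (h : IsStable W V p I J) {l : ℝ} (hl : 0 < l)
    {B : ℝ≥0∞} (hB : B ≠ ⊤)
    (hloc : ∀ Λ : Finset X, ∫⁻ ω, expNorm G o p α l ω ∂localGibbs G W V Λ 0 ≤ B) :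
    (gibbsMeasures G W V ∩ expMomentSet G o p α l B).Nonempty := by
  let ν : Finset X → ProbabilityMeasure (X → ℝ) := fun Λ =>
    ⟨localGibbs G W V Λ 0, h.isProbabilityMeasure_localGibbs Λ 0⟩
  have hK := isCompact_expMomentSet (G := G) (o := o) (α := α) h.two_lt.le hl hB
  let U : Ultrafilter (Finset X) := Ultrafilter.of atTop
  have hU : (U : Filter (Finset X)) ≤ atTop := Ultrafilter.of_le _
  obtain ⟨μ, hμK, hμ⟩ := hK.ultrafilter_le_nhds (U.map ν) (by
    rw [le_principal_iff]
    exact mem_map.2 (univ_mem' hloc))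
  have ht : Tendsto ν U (𝓝 μ) := hμ
  refine ⟨μ, (h.mem_gibbsMeasures_iff_forall_boundedContinuous μ).2 fun Δ _ f => ?_, hμK⟩
  have h1 := ((ProbabilityMeasure.continuous_lintegral_boundedContinuousFunction f).tendsto μ).comp
    ht
  have h2 := ((h.continuous_lintegral_lintegral_localGibbs (G := G) Δ f).tendsto μ).comp ht
  refine tendsto_nhds_unique h1 (h2.congr' ?_)
  filter_upwards [hU (eventually_ge_atTop Δ)] with Λ hΛ
  exact h.lintegral_lintegral_localGibbs hΛ 0 (by fun_prop)

end Gibbs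

end

end GibbsField

/-! ### Assembly of the main theorem -/

open GibbsField

theorem theorem2p1 {X : Type*} [Countable X]
    (G : SimpleGraph X) [G.LocallyFinite] (hG : G.Connected)
    (o : X) (α θ : ℝ) (hα : 0 < α) (hθ : 0 < θ)
    (hsum : graphSum G o α θ < ⊤)
    (W : ℝ → ℝ → ℝ) (hWcont : Continuous (fun z : ℝ × ℝ => W z.1 z.2))
    (hWsymm : ∀ u v : ℝ, W u v = W v u)
    (IW JW : ℝ) (hIW : 0 < IW) (hJW : 0 < JW)
    (hW : ∀ u v : ℝ, |W u v| ≤ (IW + JW * (u ^ 2 + v ^ 2)) / 2)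
    (V : ℝ → ℝ) (hVcont : Continuous V)
    (aV cV q : ℝ) (haV : 0 < aV) (hcV : 0 < cV) (hq : 2 + 2 / θ < q)
    (hV : ∀ u : ℝ, aV * |u| ^ q - cV ≤ V u)
    (p : ℝ) (hp : p = 2 + 2 / θ) :
    (temperedGibbs G W V o p α).Nonempty ∧
    IsCompact (temperedGibbs G W V o p α) ∧
    (∀ l : ℝ, 0 < l → ∀ x : X, ∃ C : ℝ, 0 < C ∧ ∀ μ ∈ temperedGibbs G W V o p α,
      ∫⁻ ω, ENNReal.ofReal (Real.exp (l * |ω x| ^ p)) ∂(μ : Measure (X → ℝ))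
        ≤ ENNReal.ofReal C) ∧
    (∀ l : ℝ, 0 < l → ∃ C : ℝ, 0 < C ∧ ∀ μ ∈ temperedGibbs G W V o p α,
      ∫⁻ ω, EReal.exp ((ENNReal.ofReal l * (wnorm G o p α ω) ^ p : ℝ≥0∞) : EReal)
          ∂(μ : Measure (X → ℝ))
        ≤ ENNReal.ofReal C) := by
  have hp2 : 2 < p := by
    have : 0 < 2 / θ := by positivity
    linarith
  have h : IsStable W V p IW JW := by
    refine ⟨hWcont, hWsymm, hIW, hJW, hW, hVcont, hp2, fun l => ?_⟩
    obtain ⟨C, hC⟩ := exists_mul_rpow_le (by linarith : 0 < p) (hp ▸ hq) haV l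
    exact ⟨C + cV, fun u => by linarith [hC |u| (abs_nonneg u), hV u]⟩
  have hmoment := fun {l : ℝ} (hl : 0 < l) => h.exists_expMoment_le hG hα hθ hp hsum hl
  obtain ⟨C, hC, hCloc⟩ := hmoment one_pos
  -- Temperedness alone is not a closed condition; the a priori bound replaces it by membership in a
  -- compact set.
  have heq : temperedGibbs G W V o p α = gibbsMeasures G W V ∩
      expMomentSet G o p α 1 (ENNReal.ofReal (Real.exp C)) :=
    Set.Subset.antisymm (fun μ hμ => ⟨hμ.1, hC μ hμ⟩) fun μ hμ =>
      h.mem_temperedGibbs_of_expMoment one_pos ENNReal.ofReal_ne_top hμ.1 hμ.2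
  refine ⟨?_, ?_, fun l hl x => ?_, fun l hl => ?_⟩
  · rw [heq]
    exact h.nonempty_gibbsMeasures_inter one_pos ENNReal.ofReal_ne_top hCloc
  · rw [heq]
    exact (isCompact_expMomentSet hp2.le one_pos ENNReal.ofReal_ne_top).inter_left
      h.isClosed_gibbsMeasures
  · have hw : 0 < weight G o α x := weight_pos x
    -- At parameter `l / w_α(x)` the single term of the norm at `x` already equals `l|ω(x)|^p`.
    have hlw : 0 < l / weight G o α x := div_pos hl hw
    obtain ⟨D, hD, -⟩ := hmoment hlw
    refine ⟨Real.exp D, Real.exp_pos D, fun μ hμ => le_trans (lintegral_mono fun ω => ?_) (hD μ hμ)⟩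
    have h1 := ofReal_exp_sum_le_expNorm (G := G) (o := o) (α := α) (by linarith : 0 < p)
      hlw.le {x} ω
    rwa [Finset.sum_singleton, mul_comm (|ω x| ^ p), ← mul_assoc, div_mul_cancel₀ _ hw.ne'] at h1
  · obtain ⟨D, hD, -⟩ := hmoment hl
    exact ⟨Real.exp D, Real.exp_pos D, hD⟩
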